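/- Let $S=\mathrm{Spec}(A)$ be an affine scheme over $\mathbb C$, and let $\mathcal G=\mathrm{Spec}(B)\rightrightarrows S$ be an affine groupoid over $\mathbb C$ with projections $p_1,p_2:\mathcal G\to S$, unit $1:S\to\mathcal G$ and multiplication $\mathrm{mult}:\mathcal G\times_{p_2,S,p_1}\mathcal G\to\mathcal G$. Let $\mathcal C'$ be an $A$-linear abelian category with exact small filtered colimits. For an $A$-module $M=\mathrm{coker}(A^{(I)}\to A^{(J)})$ and $X\in\mathcal C'$ put $M\otimes_A X=\mathrm{coker}(X^{(I)}\to X^{(J)})$; the object $X$ is called $\mathcal O_S$-flat if the functor $M\mapsto M\otimes_A X$ from $A$-modules to $\mathcal C'$ is exact. For $f:S'=\mathrm{Spec}(R)\to S$ let $\mathcal C'\times_S S'$ be the category of objects of $\mathcal C'$ with an action of $R$ that extends the action of $A$, and let $f^*:\mathcal C'\to\mathcal C'\times_S S'$ be $X\mapsto R\otimes_A X$ (similarly for morphisms $S''\to S'$ over $S$). Suppose that $\mathcal G$ acts on $\mathcal C'$: there are given a functor $\mathrm{act}^*:\mathcal C'\to\mathcal C'\times_{S,p_1}\mathcal G$,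 $\mathcal O_S$-linear when the target is regarded as a category over $S$ through $p_2$, and isomorphisms of functors $1^*\circ\mathrm{act}^*\simeq\mathrm{id}$ and $\mathrm{mult}^*\circ\mathrm{act}^*\simeq(\mathrm{act}^*\times\mathrm{id}_{\mathcal G})\circ\mathrm{act}^*$ that satisfy the usual unit and associativity compatibilities. A $\mathcal G$-equivariant object is an object $X\in\mathcal C'$ with an isomorphism $p_1^*(X)\simeq\mathrm{act}^*(X)$ in $\mathcal C'\times_{S,p_1}\mathcal G$ compatible with the unit and associativity constraints. If the morphism $(p_1,p_2):\mathcal G\to S\times S$ (product over $\mathbb C$) is flat, then for every $\mathcal G$-equivariant object of $\mathcal C'$ the underlying object $X\in\mathcal C'$ is $\mathcal O_S$-flat. -/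

import Mathlib

open CategoryTheory CategoryTheory.Limits

universe w v u

/-! ### Fibre products of affine schemes, on the level of rings -/

namespace CatOverStack

section TensorLift

variable {A B B' T : Type*} [CommRing A] [CommRing B] [CommRing B'] [Algebra A B] [Algebra A B']
  [Ring T] (φ : B →+* T) (ψ : B' →+* T) (h : ∀ a, φ (algebraMap A B a) = ψ (algebraMap A B' a))

/-- The additive map `b ⊗ b' ↦ φ b * ψ b'`. -/
noncomputable def tensorLiftAdd : TensorProduct A B B' →+ T :=
  TensorProduct.liftAddHom ((AddMonoidHom.mul.compl₂ ψ.toAddMonoidHom).comp φ.toAddMonoidHom) (by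
    intro a b b'
    change φ (a • b) * ψ b' = φ b * ψ (a • b')
    rw [Algebra.smul_def, Algebra.smul_def, mul_comm, map_mul, map_mul, h, mul_assoc])

theorem tensorLiftAdd_tmul (b : B) (b' : B') :
    tensorLiftAdd (A := A) φ ψ h (b ⊗ₜ[A] b') = φ b * ψ b' := rfl

/-- The ring homomorphism `b ⊗ b' ↦ φ b * ψ b'`. -/
noncomputable def tensorLift (hc : ∀ b b', φ b * ψ b' = ψ b' * φ b) :
    TensorProduct A B B' →+* T :=
  { tensorLiftAdd (A := A) φ ψ h with
    map_one' := by
      change tensorLiftAdd (A := A) φ ψ h ((1 : B) ⊗ₜ[A] (1 : B')) = 1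
      rw [tensorLiftAdd_tmul, map_one, map_one, mul_one]
    map_mul' := by
      intro x y
      change tensorLiftAdd (A := A) φ ψ h (x * y) =
        tensorLiftAdd (A := A) φ ψ h x * tensorLiftAdd (A := A) φ ψ h y
      induction x using TensorProduct.induction_on with
      | zero => rw [zero_mul, map_zero, zero_mul]
      | add x x' hx hx' => rw [add_mul, map_add, map_add, add_mul, hx, hx']
      | tmul b b' =>
        induction y using TensorProduct.induction_on with
        | zero => rw [mul_zero, map_zero, mul_zero]
        | add y y' hy hy' => rw [mul_add, map_add, map_add, mul_add, hy, hy']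
        | tmul c c' =>
          rw [Algebra.TensorProduct.tmul_mul_tmul, tensorLiftAdd_tmul, tensorLiftAdd_tmul,
            tensorLiftAdd_tmul, map_mul, map_mul, mul_assoc, mul_assoc, ← mul_assoc (φ c), hc,
            mul_assoc] }

theorem tmul_eq (b : B) (b' : B') : (b ⊗ₜ[A] (1 : B')) * ((1 : B) ⊗ₜ[A] b') = b ⊗ₜ[A] b' := by
  rw [Algebra.TensorProduct.tmul_mul_tmul, mul_one, one_mul]

end TensorLift

section PushoutRing

variable {A B B' : Type*} [CommRing A] [CommRing B] [CommRing B']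

/-- The ring `B ⊗[A] B'`, where `B` and `B'` are `A`-algebras through the given homomorphisms
`f` and `g`; this is the ring of functions on `Spec B ×_{f, Spec A, g} Spec B'`. -/
def PushoutRing (f : A →+* B) (g : A →+* B') : Type _ :=
  letI := f.toAlgebra
  letI := g.toAlgebra
  TensorProduct A B B'

noncomputable instance (f : A →+* B) (g : A →+* B') : CommRing (PushoutRing f g) :=
  letI := f.toAlgebra
  letI := g.toAlgebra
  (inferInstance : CommRing (TensorProduct A B B'))

namespace PushoutRing

/-- `b ↦ b ⊗ 1` (the first projection). -/
noncomputable def inl (f : A →+* B) (g : A →+* B') : B →+* PushoutRing f g :=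
  letI := f.toAlgebra
  letI := g.toAlgebra
  Algebra.TensorProduct.includeLeftRingHom (R := A) (A := B) (B := B')

/-- `b' ↦ 1 ⊗ b'` (the second projection). -/
noncomputable def inr (f : A →+* B) (g : A →+* B') : B' →+* PushoutRing f g :=
  letI := f.toAlgebra
  letI := g.toAlgebra
  (Algebra.TensorProduct.includeRight (R := A) (A := B) (B := B')).toRingHom

theorem condition (f : A →+* B) (g : A →+* B') (a : A) :
    inl f g (f a) = inr f g (g a) := by
  let := f.toAlgebra
  let := g.toAlgebra
  change (f a) ⊗ₜ[A] (1 : B') = (1 : B) ⊗ₜ[A] (g a)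
  have h1 : f a = a • (1 : B) := by rw [Algebra.smul_def, mul_one]; rfl
  have h2 : g a = a • (1 : B') := by rw [Algebra.smul_def, mul_one]; rfl
  rw [h1, h2, TensorProduct.smul_tmul]

/-- The homomorphism `b ⊗ b' ↦ φ b * ψ b'` to a ring `T`, not necessarily commutative, for
homomorphisms `φ` and `ψ` that agree on `A` and have commuting images. -/
noncomputable def lift {T : Type*} [Ring T] (f : A →+* B) (g : A →+* B')
    (φ : B →+* T) (ψ : B' →+* T) (h : ∀ a, φ (f a) = ψ (g a))
    (hc : ∀ b b', φ b * ψ b' = ψ b' * φ b) : PushoutRing f g →+* T :=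
  letI := f.toAlgebra
  letI := g.toAlgebra
  tensorLift (A := A) φ ψ h hc

@[simp]
theorem lift_inl {T : Type*} [Ring T] (f : A →+* B) (g : A →+* B')
    (φ : B →+* T) (ψ : B' →+* T) (h : ∀ a, φ (f a) = ψ (g a))
    (hc : ∀ b b', φ b * ψ b' = ψ b' * φ b) (b : B) :
    lift f g φ ψ h hc (inl f g b) = φ b := by
  change φ b * ψ 1 = φ b
  rw [map_one, mul_one]

@[simp]
theorem lift_inr {T : Type*} [Ring T] (f : A →+* B) (g : A →+* B')
    (φ : B →+* T) (ψ : B' →+* T) (h : ∀ a, φ (f a) = ψ (g a))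
    (hc : ∀ b b', φ b * ψ b' = ψ b' * φ b) (b' : B') :
    lift f g φ ψ h hc (inr f g b') = ψ b' := by
  change φ 1 * ψ b' = ψ b'
  rw [map_one, one_mul]

/-- Induction principle: every element is a sum of products `inl b * inr b'`. -/
theorem induction_on {f : A →+* B} {g : A →+* B'} {P : PushoutRing f g → Prop}
    (x : PushoutRing f g) (mul : ∀ b b', P (inl f g b * inr f g b'))
    (add : ∀ x y, P x → P y → P (x + y)) : P x := by
  let := f.toAlgebra
  let := g.toAlgebra
  have key : ∀ b b', inl f g b * inr f g b' = (b ⊗ₜ[A] b' : TensorProduct A B B') := by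
    intro b b'
    exact tmul_eq b b'
  induction x using TensorProduct.induction_on with
  | zero =>
    have h0 := mul 0 0
    rw [map_zero, zero_mul] at h0
    exact h0
  | tmul b b' =>
    have h0 := mul b b'
    rw [key] at h0
    exact h0
  | add x y hx hy => exact add x y hx hy

theorem lift_inl_inr (f : A →+* B) (g : A →+* B') (x : PushoutRing f g) :
    lift f g (inl f g) (inr f g) (condition f g) (fun _ _ => mul_comm _ _) x = x := by
  induction x using PushoutRing.induction_on with
  | mul b b' => rw [map_mul, lift_inl, lift_inr]
  | add x y hx hy => rw [map_add, hx, hy]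

end PushoutRing

end PushoutRing

/-! ### Affine groupoids -/

/-- The structure maps of an affine groupoid `𝒢 = Spec B` over `S = Spec A` (over `ℂ`), given by
the dual homomorphisms of rings of functions. A pair `(g, h)` of points of `𝒢` is composable when
`p₂ g = p₁ h`. (Given the axioms below, `unit`, `mult` and `inv` are automatically `ℂ`-linear,
because `p₁` and `p₂` are.) -/
structure AffineGroupoidData (A B : Type w) [CommRing A] [Algebra ℂ A] [CommRing B]
    [Algebra ℂ B] where
  /-- The projection `p₁ : 𝒢 → S`. -/
  p₁ : A →ₐ[ℂ] B
  /-- The projection `p₂ : 𝒢 → S`. -/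
  p₂ : A →ₐ[ℂ] B
  /-- The unit map `1 : S → 𝒢`. -/
  unit : B →+* A
  /-- The multiplication map `𝒢 ×_{p₂, S, p₁} 𝒢 → 𝒢`. -/
  mult : B →+* PushoutRing (p₂ : A →+* B) (p₁ : A →+* B)
  /-- The inversion map `𝒢 → 𝒢`. -/
  inv : B →+* B

namespace AffineGroupoidData

variable {A B : Type w} [CommRing A] [Algebra ℂ A] [CommRing B] [Algebra ℂ B]
  (G : AffineGroupoidData A B) {T : Type w} [CommRing T]

/-- `p₁` on `T`-points. -/
def src (g : B →+* T) : A →+* T := g.comp (G.p₁ : A →+* B)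

/-- `p₂` on `T`-points. -/
def tgt (g : B →+* T) : A →+* T := g.comp (G.p₂ : A →+* B)

/-- The unit map on `T`-points. -/
def one (s : A →+* T) : B →+* T := s.comp G.unit

/-- The inversion on `T`-points. -/
def inverse (g : B →+* T) : B →+* T := g.comp G.inv

/-- The product `g h` of composable `T`-points. -/
noncomputable def mul (g h : B →+* T) (e : G.tgt g = G.src h) : B →+* T :=
  (PushoutRing.lift (G.p₂ : A →+* B) (G.p₁ : A →+* B) g h
    (fun a => congrArg (fun s : A →+* T => s a) e) (fun _ _ => mul_comm _ _)).comp G.mult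

end AffineGroupoidData

/-- An affine groupoid `𝒢 = Spec B ⇉ S = Spec A`: for every commutative ring `T` the structure
maps make the `T`-points of `𝒢` a groupoid with objects the `T`-points of `S`. -/
structure AffineGroupoid (A B : Type w) [CommRing A] [Algebra ℂ A] [CommRing B]
    [Algebra ℂ B] extends AffineGroupoidData A B where
  src_one : ∀ {T : Type w} [CommRing T] (s : A →+* T),
    toAffineGroupoidData.src (toAffineGroupoidData.one s) = s
  tgt_one : ∀ {T : Type w} [CommRing T] (s : A →+* T),
    toAffineGroupoidData.tgt (toAffineGroupoidData.one s) = s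
  src_mul : ∀ {T : Type w} [CommRing T] (g h : B →+* T)
    (e : toAffineGroupoidData.tgt g = toAffineGroupoidData.src h),
    toAffineGroupoidData.src (toAffineGroupoidData.mul g h e) = toAffineGroupoidData.src g
  tgt_mul : ∀ {T : Type w} [CommRing T] (g h : B →+* T)
    (e : toAffineGroupoidData.tgt g = toAffineGroupoidData.src h),
    toAffineGroupoidData.tgt (toAffineGroupoidData.mul g h e) = toAffineGroupoidData.tgt h
  src_inverse : ∀ {T : Type w} [CommRing T] (g : B →+* T),
    toAffineGroupoidData.src (toAffineGroupoidData.inverse g) = toAffineGroupoidData.tgt g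
  tgt_inverse : ∀ {T : Type w} [CommRing T] (g : B →+* T),
    toAffineGroupoidData.tgt (toAffineGroupoidData.inverse g) = toAffineGroupoidData.src g
  one_mul : ∀ {T : Type w} [CommRing T] (g : B →+* T),
    toAffineGroupoidData.mul (toAffineGroupoidData.one (toAffineGroupoidData.src g)) g
      (tgt_one _) = g
  mul_one : ∀ {T : Type w} [CommRing T] (g : B →+* T),
    toAffineGroupoidData.mul g (toAffineGroupoidData.one (toAffineGroupoidData.tgt g))
      (src_one _).symm = g
  inverse_mul : ∀ {T : Type w} [CommRing T] (g : B →+* T),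
    toAffineGroupoidData.mul (toAffineGroupoidData.inverse g) g (tgt_inverse g) =
      toAffineGroupoidData.one (toAffineGroupoidData.tgt g)
  mul_inverse : ∀ {T : Type w} [CommRing T] (g : B →+* T),
    toAffineGroupoidData.mul g (toAffineGroupoidData.inverse g) (src_inverse g).symm =
      toAffineGroupoidData.one (toAffineGroupoidData.src g)
  mul_assoc : ∀ {T : Type w} [CommRing T] (g h k : B →+* T)
    (e : toAffineGroupoidData.tgt g = toAffineGroupoidData.src h)
    (e' : toAffineGroupoidData.tgt h = toAffineGroupoidData.src k),
    toAffineGroupoidData.mul (toAffineGroupoidData.mul g h e) k ((tgt_mul g h e).trans e') =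
      toAffineGroupoidData.mul g (toAffineGroupoidData.mul h k e')
        (e.trans (src_mul h k e').symm)

namespace AffineGroupoid

variable {A B : Type w} [CommRing A] [Algebra ℂ A] [CommRing B] [Algebra ℂ B]
  (G : AffineGroupoid A B)

/-- `𝒢` is flat over `S × S` (product over `ℂ`) through `(p₁, p₂)`. -/
def FlatOverSquare : Prop :=
  (Algebra.TensorProduct.lift G.p₁ G.p₂ (fun _ _ => mul_comm _ _) :
    TensorProduct ℂ A A →ₐ[ℂ] B).toRingHom.Flat

theorem unit_comp_p₁ (a : A) : G.unit (G.p₁ a) = a :=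
  congrArg (fun s : A →+* A => s a) (G.src_one (RingHom.id A))

theorem mult_p₁ (a : A) : G.mult (G.p₁ a) =
    PushoutRing.inl (G.p₂ : A →+* B) (G.p₁ : A →+* B) (G.p₁ a) := by
  have e : G.tgt (PushoutRing.inl (G.p₂ : A →+* B) (G.p₁ : A →+* B)) =
      G.src (PushoutRing.inr (G.p₂ : A →+* B) (G.p₁ : A →+* B)) :=
    RingHom.ext (PushoutRing.condition (G.p₂ : A →+* B) (G.p₁ : A →+* B))
  have h := congrArg (fun s : A →+* _ => s a) (G.src_mul _ _ e)
  refine Eq.trans ?_ h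
  exact (PushoutRing.lift_inl_inr _ _ _).symm

end AffineGroupoid

/-! ### Tensor products of modules with objects -/

section Tensor

variable {R : Type w} [CommRing R] {C : Type u} [Category.{v} C] [Preadditive C]

variable (R C) in
/-- An object of `C` with an action of the ring `R`. -/
structure ActedObj where
  /-- the object -/
  obj : C
  /-- the action -/
  ρ : R →+* End obj

namespace ActedObj

/-- The action of an element. -/
def act (Y : ActedObj R C) (r : R) : Y.obj ⟶ Y.obj := Y.ρ r

theorem act_one (Y : ActedObj R C) : Y.act 1 = 𝟙 _ := map_one Y.ρ

theorem act_mul (Y : ActedObj R C) (r s : R) : Y.act (r * s) = Y.act r ≫ Y.act s := by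
  rw [mul_comm]; exact map_mul Y.ρ s r

theorem act_zero (Y : ActedObj R C) : Y.act 0 = 0 := map_zero Y.ρ

theorem act_add (Y : ActedObj R C) (r s : R) : Y.act (r + s) = Y.act r + Y.act s :=
  map_add Y.ρ r s

end ActedObj

variable (R) in
/-- An object of an `R`-linear category, with its tautological action of `R`. -/
def linearActed [Linear R C] (X : C) : ActedObj R C where
  obj := X
  ρ := algebraMap R (End X)

theorem linearActed_act [Linear R C] (X : C) (r : R) : (linearActed R X).act r = r • 𝟙 X := rfl

variable [HasCoproducts.{w} C] [HasCokernels C]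

variable (R) in
/-- The module of relations of `M` with respect to the generating family of all its elements, so
that `R^(relations) → R^(M) → M → 0` is a presentation of `M`. -/
noncomputable abbrev relations (M : Type w) [AddCommGroup M] [Module R M] : Submodule R (M →₀ R) :=
  LinearMap.ker (Finsupp.linearCombination R (id : M → M))

variable (M : Type w) [AddCommGroup M] [Module R M] (Y : ActedObj R C)

/-- The map `X^(I) ⟶ X^(J)` attached to the presentation `R^(I) → R^(J) → M → 0` above: its matrix
entries are the actions of the entries of the matrix `R^(I) → R^(J)`. -/
noncomputable def relationsMap :
    (∐ fun _ : relations R M => Y.obj) ⟶ (∐ fun _ : M => Y.obj) :=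
  Sigma.desc fun r => r.1.sum fun m a => Y.act a ≫ Sigma.ι (fun _ : M => Y.obj) m

/-- The tensor product `M ⊗[R] Y`, defined as `coker (X^(I) ⟶ X^(J))` for the presentation
`coker (R^(I) → R^(J))` of `M` above. -/
noncomputable abbrev tensorObj : C := cokernel (relationsMap M Y)

variable {M}

/-- The morphism `m ⊗ - : Y ⟶ M ⊗[R] Y`. -/
noncomputable def tensorMk (m : M) : Y.obj ⟶ tensorObj M Y :=
  Sigma.ι (fun _ : M => Y.obj) m ≫ cokernel.π (relationsMap M Y)

theorem tensorMk_relation (r : relations R M) :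
    (r.1.sum fun m a => Y.act a ≫ tensorMk Y m) = 0 := by
  have h : Sigma.ι (fun _ : relations R M => Y.obj) r ≫
      relationsMap M Y ≫ cokernel.π (relationsMap M Y) = 0 := by
    rw [cokernel.condition, comp_zero]
  have e : Sigma.ι (fun _ : relations R M => Y.obj) r ≫ relationsMap M Y =
      r.1.sum fun m a => Y.act a ≫ Sigma.ι (fun _ : M => Y.obj) m := Sigma.ι_desc _ _
  rw [← Category.assoc, e, Finsupp.sum, Preadditive.sum_comp] at h
  refine Eq.trans ?_ h
  exact Finset.sum_congr rfl fun m _ => (Category.assoc _ _ _).symm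

theorem tensorMk_add (m n : M) : tensorMk Y (m + n) = tensorMk Y m + tensorMk Y n := by
  have h := tensorMk_relation Y (M := M)
    ⟨Finsupp.single (m + n) 1 - Finsupp.single m 1 - Finsupp.single n 1, by
      simp [LinearMap.mem_ker]⟩
  have h0 : ∀ k : M, Y.act 0 ≫ tensorMk Y k = 0 := fun k => by rw [Y.act_zero, zero_comp]
  have hs : ∀ (k : M) (b c : R), Y.act (b - c) ≫ tensorMk Y k =
      Y.act b ≫ tensorMk Y k - Y.act c ≫ tensorMk Y k := fun k b c => by
    rw [← Preadditive.sub_comp]; congr 1; exact map_sub Y.ρ b c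
  rw [Finsupp.sum_sub_index hs, Finsupp.sum_sub_index hs, Finsupp.sum_single_index (h0 _),
    Finsupp.sum_single_index (h0 _), Finsupp.sum_single_index (h0 _), Y.act_one,
    Category.id_comp, Category.id_comp, Category.id_comp, sub_sub, sub_eq_zero] at h
  exact h

theorem tensorMk_zero : tensorMk Y (0 : M) = 0 := by
  have := tensorMk_add Y (0 : M) 0
  simpa using this

theorem tensorMk_smul (r : R) (m : M) : tensorMk Y (r • m) = Y.act r ≫ tensorMk Y m := by
  have h := tensorMk_relation Y (M := M)
    ⟨Finsupp.single (r • m) 1 - Finsupp.single m r, by simp [LinearMap.mem_ker]⟩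
  have h0 : ∀ k : M, Y.act 0 ≫ tensorMk Y k = 0 := fun k => by rw [Y.act_zero, zero_comp]
  have hs : ∀ (k : M) (b c : R), Y.act (b - c) ≫ tensorMk Y k =
      Y.act b ≫ tensorMk Y k - Y.act c ≫ tensorMk Y k := fun k b c => by
    rw [← Preadditive.sub_comp]; congr 1; exact map_sub Y.ρ b c
  rw [Finsupp.sum_sub_index hs, Finsupp.sum_single_index (h0 _),
    Finsupp.sum_single_index (h0 _), Y.act_one, Category.id_comp, sub_eq_zero] at h
  exact h

@[ext]
theorem tensor_hom_ext {Z : C} {f g : tensorObj M Y ⟶ Z}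
    (h : ∀ m, tensorMk Y m ≫ f = tensorMk Y m ≫ g) : f = g := by
  apply (cancel_epi (cokernel.π (relationsMap M Y))).1
  apply Sigma.hom_ext
  intro m
  have := h m
  rw [tensorMk, Category.assoc, Category.assoc] at this
  exact this

/-- The universal property: a morphism out of `M ⊗[R] Y` is an `R`-linear family of morphisms out
of `Y` indexed by `M`. -/
noncomputable def tensorDesc {Z : C} (φ : M →+ (Y.obj ⟶ Z))
    (hφ : ∀ (r : R) (m : M), φ (r • m) = Y.act r ≫ φ m) : tensorObj M Y ⟶ Z :=
  cokernel.desc (relationsMap M Y) (Sigma.desc fun m => φ m) (by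
    apply Sigma.hom_ext
    intro r
    have hr : (r.1.sum fun m a => a • m) = 0 := by
      have := LinearMap.mem_ker.1 r.2
      rwa [Finsupp.linearCombination_apply] at this
    have h := congrArg φ hr
    rw [Finsupp.sum, map_sum, map_zero] at h
    rw [relationsMap, ← Category.assoc, Sigma.ι_desc, comp_zero, Finsupp.sum,
      Preadditive.sum_comp, ← h]
    refine Finset.sum_congr rfl fun m _ => ?_
    rw [Category.assoc, Sigma.ι_desc, hφ])

@[simp]
theorem tensorMk_desc {Z : C} (φ : M →+ (Y.obj ⟶ Z))
    (hφ : ∀ (r : R) (m : M), φ (r • m) = Y.act r ≫ φ m) (m : M) :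
    tensorMk Y m ≫ tensorDesc Y φ hφ = φ m := by
  rw [tensorMk, tensorDesc, Category.assoc, cokernel.π_desc, Sigma.ι_desc]

variable {N : Type w} [AddCommGroup N] [Module R N]

/-- The morphism `M ⊗[R] Y ⟶ N ⊗[R] Z` induced by a linear map `M → N` and an equivariant morphism
`Y ⟶ Z`. -/
noncomputable def tensorMap {Y Z : ActedObj R C} (φ : M →ₗ[R] N) (f : Y.obj ⟶ Z.obj)
    (hf : ∀ r, Y.act r ≫ f = f ≫ Z.act r) : tensorObj M Y ⟶ tensorObj N Z :=
  tensorDesc Y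
    { toFun := fun m => f ≫ tensorMk Z (φ m)
      map_zero' := by rw [map_zero, tensorMk_zero, comp_zero]
      map_add' := fun m n => by rw [map_add, tensorMk_add, Preadditive.comp_add] }
    (fun r m => by
      change f ≫ tensorMk Z (φ (r • m)) = Y.act r ≫ f ≫ tensorMk Z (φ m)
      rw [map_smul, tensorMk_smul, ← Category.assoc, ← Category.assoc, hf])

theorem tensorMk_map {Y Z : ActedObj R C} (φ : M →ₗ[R] N) (f : Y.obj ⟶ Z.obj)
    (hf : ∀ r, Y.act r ≫ f = f ≫ Z.act r) (m : M) :
    tensorMk Y m ≫ tensorMap φ f hf = f ≫ tensorMk Z (φ m) :=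
  tensorMk_desc ..

/-- Multiplication by `r'` on the first factor of `R' ⊗[R] Y`. -/
noncomputable def tensorMul {R' : Type w} [CommRing R'] [Algebra R R'] (Y : ActedObj R C)
    (r' : R') : tensorObj R' Y ⟶ tensorObj R' Y :=
  tensorMap (LinearMap.mulLeft R r') (𝟙 Y.obj) (fun _ => by rw [Category.comp_id, Category.id_comp])

theorem tensorMk_mul {R' : Type w} [CommRing R'] [Algebra R R'] (Y : ActedObj R C)
    (r' m : R') : tensorMk Y m ≫ tensorMul Y r' = tensorMk Y (r' * m) := by
  rw [tensorMul, tensorMk_map, Category.id_comp, LinearMap.mulLeft_apply]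

/-- The object `R' ⊗[R] Y` with its action of `R'`. -/
noncomputable def tensorActed (R' : Type w) [CommRing R'] [Algebra R R'] (Y : ActedObj R C) :
    ActedObj R' C where
  obj := tensorObj R' Y
  ρ :=
    { toFun := fun r' => tensorMul Y r'
      map_one' := by
        change tensorMul Y (1 : R') = 𝟙 _
        ext m
        rw [tensorMk_mul, one_mul, Category.comp_id]
      map_mul' := fun r s => by
        change tensorMul Y (r * s) = tensorMul Y s ≫ tensorMul Y r
        ext m
        rw [← Category.assoc, tensorMk_mul, tensorMk_mul, tensorMk_mul, mul_assoc]
      map_zero' := by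
        change tensorMul Y (0 : R') = 0
        ext m
        rw [tensorMk_mul, comp_zero, zero_mul, tensorMk_zero]
      map_add' := fun r s => by
        change tensorMul Y (r + s) = tensorMul Y r + tensorMul Y s
        ext m
        rw [Preadditive.comp_add, tensorMk_mul, tensorMk_mul, tensorMk_mul, add_mul,
          tensorMk_add] }

theorem tensorActed_act (R' : Type w) [CommRing R'] [Algebra R R'] (Y : ActedObj R C) (r' : R') :
    (tensorActed R' Y).act r' = tensorMul Y r' := rfl

variable (R) in
/-- The functor `M ↦ M ⊗[R] X` for an object `X` of an `R`-linear category. -/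
noncomputable def tensorFunctor [Linear R C] (X : C) : ModuleCat.{w} R ⥤ C where
  obj M := tensorObj M (linearActed R X)
  map φ := tensorMap φ.hom (𝟙 (linearActed R X).obj)
    (fun _ => by rw [Category.comp_id, Category.id_comp])
  map_id M := by
    ext m
    rw [tensorMk_map]
    exact (Category.id_comp _).trans (Category.comp_id _).symm
  map_comp f g := by
    ext m
    rw [← Category.assoc, tensorMk_map, tensorMk_map, Category.assoc, tensorMk_map]
    exact (Category.id_comp _).symm

theorem tensorMap_comp {P : Type w} [AddCommGroup P] [Module R P] {Y Z W : ActedObj R C}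
    (φ : M →ₗ[R] N) (ψ : N →ₗ[R] P) (f : Y.obj ⟶ Z.obj) (g : Z.obj ⟶ W.obj)
    (hf : ∀ r, Y.act r ≫ f = f ≫ Z.act r) (hg : ∀ r, Z.act r ≫ g = g ≫ W.act r)
    (hfg : ∀ r, Y.act r ≫ (f ≫ g) = (f ≫ g) ≫ W.act r) :
    tensorMap φ f hf ≫ tensorMap ψ g hg = tensorMap (ψ ∘ₗ φ) (f ≫ g) hfg := by
  ext m
  rw [← Category.assoc, tensorMk_map, Category.assoc, tensorMk_map, tensorMk_map, Category.assoc]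
  rfl

theorem tensorMk_functor_map [Linear R C] (X : C) {M N : ModuleCat.{w} R} (f : M ⟶ N) (m : M) :
    tensorMk (linearActed R X) m ≫ (tensorFunctor R X).map f =
      tensorMk (linearActed R X) (f.hom m) :=
  (tensorMk_map f.hom (𝟙 (linearActed R X).obj)
    (fun _ => by rw [Category.comp_id, Category.id_comp]) m).trans (Category.id_comp _)

instance [Linear R C] (X : C) : (tensorFunctor R X).Additive where
  map_add {M N f g} := by
    apply tensor_hom_ext
    intro m
    refine Eq.trans ?_ (Preadditive.comp_add ..).symm
    refine (tensorMk_functor_map X (f + g) m).trans (Eq.trans ?_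
      (congrArg₂ (· + ·) (tensorMk_functor_map X f m).symm (tensorMk_functor_map X g m).symm))
    exact tensorMk_add _ _ _

variable (R) in
/-- `X` is flat over `R`: the functor `M ↦ M ⊗[R] X` is exact. -/
def IsFlat [Linear R C] (X : C) : Prop :=
  ∀ S : ShortComplex (ModuleCat.{w} R), S.ShortExact → (S.map (tensorFunctor R X)).ShortExact

end Tensor

/-! ### Change of rings -/

section BaseChange

variable {A R R' : Type w} [CommRing A] [CommRing R] [CommRing R']

/-- The base change `C ×_S S'` of an `A`-linear category `C` along `f : A → R`, with `S = Spec A`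
and `S' = Spec R`: objects of `C` with an action of `R` whose restriction along `f` is the given
action of `A`. -/
structure BaseChange (f : A →+* R) (C : Type u) [Category.{v} C] [Preadditive C]
    [Linear A C] extends ActedObj R C where
  compat : ∀ a, toActedObj.act (f a) = a • 𝟙 obj

variable {C : Type u} [Category.{v} C] [Preadditive C] [Linear A C]

namespace BaseChange

variable {f : A →+* R}

/-- Morphisms of the base change: the morphisms of `C` that commute with the action of `R`. -/
@[ext]
structure Hom (Y Z : BaseChange f C) where
  /-- the underlying morphism -/
  hom : Y.obj ⟶ Z.obj
  comm : ∀ r, Y.act r ≫ hom = hom ≫ Z.act r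

instance : Category (BaseChange f C) where
  Hom := Hom
  id Y := ⟨𝟙 _, fun _ => by rw [Category.comp_id, Category.id_comp]⟩
  comp g h := ⟨g.hom ≫ h.hom, fun r => by
    rw [← Category.assoc, g.comm, Category.assoc, h.comm, Category.assoc]⟩

@[ext]
theorem hom_ext {Y Z : BaseChange f C} {g h : Y ⟶ Z} (e : g.hom = h.hom) : g = h := Hom.ext e

@[simp] theorem id_hom (Y : BaseChange f C) : Hom.hom (𝟙 Y) = 𝟙 Y.obj := rfl

@[simp] theorem comp_hom {X Y Z : BaseChange f C} (g : X ⟶ Y) (h : Y ⟶ Z) :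
    Hom.hom (g ≫ h) = g.hom ≫ h.hom := rfl

variable (C f) in
/-- The forgetful functor `f_*` from the base change to `C`. -/
def forget : BaseChange f C ⥤ C where
  obj Y := Y.obj
  map g := g.hom

variable (A C) in
/-- `C` itself as the trivial base change; every morphism of `C` commutes with `A`. -/
def ofBase : C ⥤ BaseChange (RingHom.id A) C where
  obj X := { linearActed A X with compat := fun _ => rfl }
  map g := ⟨g, fun a => by
    change (a • 𝟙 _) ≫ g = g ≫ (a • 𝟙 _)
    rw [Linear.smul_comp, Linear.comp_smul, Category.id_comp, Category.comp_id]⟩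

variable [HasCoproducts.{w} C] [HasCokernels C]

/-- For `S'' = Spec R' → S' = Spec R → S`, the inverse image functor
`C ×_S S' ⥤ C ×_S S''`, `Y ↦ R' ⊗[R] Y`. Here `ψ : R → R'` and `g = ψ ∘ f`. -/
noncomputable def pullback (ψ : R →+* R') (g : A →+* R') (h : ∀ a, ψ (f a) = g a) :
    BaseChange f C ⥤ BaseChange g C :=
  letI := ψ.toAlgebra
  { obj := fun Y =>
      { tensorActed R' Y.toActedObj with
        compat := fun a => by
          change tensorMul Y.toActedObj (g a) = a • 𝟙 (tensorObj R' Y.toActedObj)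
          apply tensor_hom_ext
          intro m
          have e : g a * m = f a • m := by rw [← h]; rfl
          rw [tensorMk_mul, Linear.comp_smul, e, tensorMk_smul, Y.compat, Linear.smul_comp,
            Category.id_comp, Category.comp_id] }
    map := fun {Y Z} k =>
      ⟨tensorMap (LinearMap.id : R' →ₗ[R] R') k.hom k.comm, fun r' => by
        change tensorMul Y.toActedObj r' ≫ _ = _ ≫ tensorMul Z.toActedObj r'
        apply tensor_hom_ext
        intro m
        rw [← Category.assoc, tensorMk_mul, tensorMk_map, ← Category.assoc, tensorMk_map,
          Category.assoc, tensorMk_mul]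
        rfl⟩
    map_id := fun Y => by
      apply hom_ext
      apply tensor_hom_ext
      intro m
      exact (tensorMk_map (LinearMap.id : R' →ₗ[R] R') (𝟙 Y.obj)
        (fun _ => by rw [Category.comp_id, Category.id_comp]) m).trans
        ((Category.id_comp _).trans (Category.comp_id _).symm)
    map_comp := fun k l => hom_ext (tensorMap_comp (LinearMap.id : R' →ₗ[R] R')
      (LinearMap.id : R' →ₗ[R] R') k.hom l.hom k.comm l.comm (k ≫ l).comm).symm }

/-- The adjunction morphism `1 ⊗ - : Y ⟶ R' ⊗[R] Y` in `C`. -/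
noncomputable def toPullback (ψ : R →+* R') (g : A →+* R') (h : ∀ a, ψ (f a) = g a)
    (Y : BaseChange f C) : Y.obj ⟶ ((pullback ψ g h).obj Y).obj :=
  letI := ψ.toAlgebra
  tensorMk Y.toActedObj (1 : R')

variable (C) in
/-- The inverse image functor `f^* : C ⥤ C ×_S S'`, `X ↦ R ⊗[A] X`. -/
noncomputable def baseChange (f : A →+* R) : C ⥤ BaseChange f C :=
  ofBase A C ⋙ pullback f f (fun _ => rfl)

/-- The adjunction morphism `X ⟶ f_* f^* X`. -/
noncomputable def toBaseChange (f : A →+* R) (X : C) : X ⟶ ((baseChange C f).obj X).obj :=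
  toPullback f f (fun _ => rfl) ((ofBase A C).obj X)

end BaseChange

end BaseChange

/-! ### Actions of a groupoid on a category, and equivariant objects -/

namespace AffineGroupoid

variable {A B : Type w} [CommRing A] [Algebra ℂ A] [CommRing B] [Algebra ℂ B]
  (G : AffineGroupoid A B) (C : Type u) [Category.{v} C] [Preadditive C] [Linear A C]

/-- A functor `act^* : C ⥤ C ×_{S, p₁} 𝒢` that is `𝒪_S`-linear when the target is a category over
`S` through `p₂ : 𝒢 → S`. -/
structure ActFunctor where
  /-- the functor -/
  act : C ⥤ BaseChange (G.p₁ : A →+* B) C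
  map_add : ∀ {X Y : C} (f g : X ⟶ Y), (act.map (f + g)).hom = (act.map f).hom + (act.map g).hom
  map_smul : ∀ {X Y : C} (a : A) (f : X ⟶ Y),
    (act.map (a • f)).hom = (act.map f).hom ≫ (act.obj Y).act (G.p₂ a)

namespace ActFunctor

variable {G C} (F : G.ActFunctor C)

/-- The composition `(p₁)_* ∘ act^* : C ⥤ C`. -/
def T : C ⥤ C := F.act ⋙ BaseChange.forget C (G.p₁ : A →+* B)

/-- The ring homomorphism `End X → End (act^* X)`. -/
def mapEnd (X : C) : End X →+* End (F.T.obj X) where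
  toFun e := F.T.map e
  map_one' := F.T.map_id X
  map_mul' e e' := F.T.map_comp e' e
  map_zero' := by
    have : F.T.map (0 + 0 : X ⟶ X) = F.T.map 0 + F.T.map 0 := F.map_add (0 : X ⟶ X) 0
    rw [add_zero] at this
    exact left_eq_add.1 this
  map_add' e e' := F.map_add e e'

variable {R : Type w} [CommRing R]

/-- The action of `B` on `T X`, the object underlying `act^* X`. -/
def actHom (X : C) : B →+* End (F.T.obj X) := (F.act.obj X).ρ

theorem prod_commute (g : A →+* R) (Y : BaseChange g C) (b : B) (r : R) :
    F.actHom Y.obj b * ((F.mapEnd Y.obj).comp Y.ρ) r =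
      ((F.mapEnd Y.obj).comp Y.ρ) r * F.actHom Y.obj b :=
  ((F.act.map (Y.act r)).comm b).symm

/-- The action of `B ⊗[A] R`, the ring of functions on `𝒢 ×_{p₂, S} S'` for `S' = Spec R → S`
given by `g : A → R`, on `act^* Y` for an object `Y` of `C ×_S S'`: `B` acts because `act^* Y` is an
object of `C ×_{S, p₁} 𝒢`, and `R` acts through its action on `Y`, by functoriality. -/
noncomputable def prodActed (g : A →+* R) (Y : BaseChange g C) :
    ActedObj (PushoutRing (G.p₂ : A →+* B) g) C where
  obj := F.T.obj Y.obj
  ρ := PushoutRing.lift (T := End (F.T.obj Y.obj)) (G.p₂ : A →+* B) g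
    (F.actHom Y.obj) ((F.mapEnd Y.obj).comp Y.ρ)
    (fun a => by
      change (F.act.obj Y.obj).act (G.p₂ a) = (F.act.map (Y.act (g a))).hom
      rw [Y.compat, F.map_smul, F.act.map_id, BaseChange.id_hom, Category.id_comp])
    (F.prod_commute g Y)

theorem prodActed_inl (g : A →+* R) (Y : BaseChange g C) (b : B) :
    (F.prodActed g Y).act (PushoutRing.inl (G.p₂ : A →+* B) g b) = (F.act.obj Y.obj).act b :=
  PushoutRing.lift_inl (T := End (F.T.obj Y.obj)) (hc := F.prod_commute g Y) ..

theorem prodActed_inr (g : A →+* R) (Y : BaseChange g C) (r : R) :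
    (F.prodActed g Y).act (PushoutRing.inr (G.p₂ : A →+* B) g r) = F.T.map (Y.act r) :=
  PushoutRing.lift_inr (T := End (F.T.obj Y.obj)) (hc := F.prod_commute g Y) ..

theorem prodActed_comm (g : A →+* R) {Y Z : BaseChange g C} (k : Y ⟶ Z)
    (x : PushoutRing (G.p₂ : A →+* B) g) :
    (F.prodActed g Y).act x ≫ (F.T.map k.hom : (F.prodActed g Y).obj ⟶ (F.prodActed g Z).obj) =
      F.T.map k.hom ≫ (F.prodActed g Z).act x := by
  induction x using PushoutRing.induction_on with
  | mul b r =>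
    rw [ActedObj.act_mul, ActedObj.act_mul, prodActed_inl, prodActed_inr, prodActed_inl,
      prodActed_inr]
    have e : F.T.map (Y.act r) ≫ F.T.map k.hom = F.T.map k.hom ≫ F.T.map (Z.act r) := by
      rw [← F.T.map_comp, k.comm, F.T.map_comp]
    have e' : (F.act.obj Y.obj).act b ≫ F.T.map k.hom = F.T.map k.hom ≫ (F.act.obj Z.obj).act b :=
      (F.act.map k.hom).comm b
    exact (Category.assoc _ _ _).trans ((congrArg _ e).trans ((Category.assoc _ _ _).symm.trans
      ((congrArg (· ≫ _) e').trans (Category.assoc _ _ _))))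
  | add x y hx hy =>
    rw [ActedObj.act_add, ActedObj.act_add]
    exact (Preadditive.add_comp ..).trans ((congrArg₂ (· + ·) hx hy).trans
      (Preadditive.comp_add ..).symm)

/-- For `S' = Spec R → S` given by `g : A → R`, the functor
`act^* × id_{S'} : C ×_S S' ⥤ C ×_{S, p₁} (𝒢 ×_{p₂, S} S')`. -/
noncomputable def actProd (g : A →+* R) : BaseChange g C ⥤
    BaseChange ((PushoutRing.inl (G.p₂ : A →+* B) g).comp (G.p₁ : A →+* B)) C where
  obj Y :=
    { F.prodActed g Y with
      compat := fun a => (F.prodActed_inl g Y (G.p₁ a)).trans ((F.act.obj Y.obj).compat a) }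
  map k := ⟨F.T.map k.hom, F.prodActed_comm g k⟩
  map_id Y := BaseChange.hom_ext (F.T.map_id Y.obj)
  map_comp k l := BaseChange.hom_ext (F.T.map_comp k.hom l.hom)

end ActFunctor

variable [HasCoproducts.{w} C] [HasCokernels C]

/-- The functor and the constraints of an action of `𝒢` on `C`. -/
structure ActionData extends G.ActFunctor C where
  /-- The unit constraint, an isomorphism between `1^* ∘ act^*` and the identity functor, where
  `(C ×_{S, p₁} 𝒢) ×_{𝒢, 1} S = C ×_{S, id} S` is identified with `C`. -/
  unitIso : toActFunctor.act ⋙ BaseChange.pullback G.unit (RingHom.id A) G.unit_comp_p₁ ⋙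
    BaseChange.forget C (RingHom.id A) ≅ 𝟭 C
  /-- The associativity constraint, an isomorphism between `mult^* ∘ act^*` and
  `(act^* × id_𝒢) ∘ act^*`, functors from `C` to `C ×_{S, p₁} (𝒢 ×_{p₂, S, p₁} 𝒢)`. -/
  assocIso : toActFunctor.act ⋙ BaseChange.pullback G.mult
      ((PushoutRing.inl (G.p₂ : A →+* B) (G.p₁ : A →+* B)).comp (G.p₁ : A →+* B)) G.mult_p₁ ≅
    toActFunctor.act ⋙ toActFunctor.actProd (G.p₁ : A →+* B)

namespace ActionData

variable {G C} (F : G.ActionData C)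

/-- The morphism `T X ⟶ X` in `C` that corresponds to the unit constraint `1^* (act^* X) ⟶ X` by
the adjunction between inverse and direct image. -/
noncomputable def counit (X : C) : F.T.obj X ⟶ X :=
  BaseChange.toPullback G.unit (RingHom.id A) G.unit_comp_p₁ (F.act.obj X) ≫ F.unitIso.hom.app X

/-- The morphism `T X ⟶ T (T X)` in `C` that corresponds to the associativity constraint
`mult^* (act^* X) ⟶ (act^* × id_𝒢) (act^* X)` by the adjunction between inverse and direct
image. -/
noncomputable def comult (X : C) : F.T.obj X ⟶ F.T.obj (F.T.obj X) :=
  BaseChange.toPullback G.mult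
    ((PushoutRing.inl (G.p₂ : A →+* B) (G.p₁ : A →+* B)).comp (G.p₁ : A →+* B)) G.mult_p₁
    (F.act.obj X) ≫ (F.assocIso.hom.app X).hom

end ActionData

/-- An action of `𝒢` on `C`: the constraints above are required to satisfy the usual compatibility
conditions. Each condition is an equality of two morphisms out of an inverse image of `act^* X`
(to `𝒢`, along `g ↦ (1, g)` and `g ↦ (g, 1)`, and to `𝒢 ×_S 𝒢 ×_S 𝒢`), and is stated for the
corresponding morphisms out of `T X`, for `T = (p₁)_* ∘ act^*`. -/
structure Action extends G.ActionData C where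
  /-- `act_{1 g} ≅ act_1 act_g ≅ act_g` is the identity. -/
  unit_left : ∀ X : C, toActionData.comult X ≫
    toActionData.counit (toActionData.T.obj X) = 𝟙 (toActionData.T.obj X)
  /-- `act_{g 1} ≅ act_g act_1 ≅ act_g` is the identity. -/
  unit_right : ∀ X : C, toActionData.comult X ≫
    toActionData.T.map (toActionData.counit X) = 𝟙 (toActionData.T.obj X)
  /-- The two isomorphisms `act_{g h k} ≅ act_g act_h act_k` coincide. -/
  assoc : ∀ X : C, toActionData.comult X ≫ toActionData.comult (toActionData.T.obj X) =
    toActionData.comult X ≫ toActionData.T.map (toActionData.comult X)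

variable {G C}

/-- A `𝒢`-equivariant object of `C`: an object `X` with an isomorphism `p₁^* X ≅ act^* X` in
`C ×_{S, p₁} 𝒢` that is compatible with the unit and associativity constraints; again both sides of
a compatibility are written as morphisms out of `X`, by adjunction. -/
structure EquivariantObj (F : G.Action C) where
  /-- the object -/
  obj : C
  /-- the isomorphism -/
  iso : (BaseChange.baseChange C (G.p₁ : A →+* B)).obj obj ≅ F.act.obj obj
  /-- The restriction of `iso` along the unit map is the identity of `X`. -/
  unit_compat : (BaseChange.toBaseChange (G.p₁ : A →+* B) obj ≫ iso.hom.hom) ≫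
    F.counit obj = 𝟙 obj
  /-- On `𝒢 ×_S 𝒢`, the pullback of `iso` along the multiplication is the composition of its
  pullbacks along the projections, `X ≅ act_g X ≅ act_g (act_h X)`. -/
  assoc_compat : (BaseChange.toBaseChange (G.p₁ : A →+* B) obj ≫ iso.hom.hom) ≫
      F.comult obj =
    (BaseChange.toBaseChange (G.p₁ : A →+* B) obj ≫ iso.hom.hom) ≫
      F.T.map (BaseChange.toBaseChange (G.p₁ : A →+* B) obj ≫ iso.hom.hom)

end AffineGroupoid

/-- A category with finite coproducts and small filtered colimits has small coproducts. -/
instance hasCoproducts_of_filtered (C : Type u) [Category.{v} C] [HasFiniteCoproducts C]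
    [HasFilteredColimitsOfSize.{w, w} C] : HasCoproducts.{w} C :=
  hasCoproducts_of_finite_and_filtered

end CatOverStack

/-! Tensoring with `X` is right exact for formal reasons, so flatness means that an injective `φ : M
→ N` induces a monomorphism `M ⊗ X ⟶ N ⊗ X`. In an AB5 category it suffices to test this on
elements: for every `Z`, each `t` in `Hom(Z, X) ⊗ M` that dies in `Hom(Z, X) ⊗ N` must evaluate to
zero in `Hom(Z, M ⊗ X)` (`mono_tensorFunctor_map`). In particular, universally injective maps become
monomorphisms.

The groupoid makes `φ` universally injective. Let `M'` be `B ⊗ M`, tensored through `p₂` and viewed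
over `A` through `p₁`. For an `A`-module `H` one has `H ⊗ M' = (B ⊗ H) ⊗ M`, where `B ⊗ H` is formed
through `p₁` and then tensored with `M` through `p₂`. Now `B ⊗ H` is the extension of scalars to `B`
of the `(A ⊗ A)`-module `H ⊗ A` (over `ℂ`), which is flat over the second `A`. As `B` is flat over
`A ⊗ A`, so is `B ⊗ H` over `A` through `p₂`. Hence `M' → N'` is universally injective
(`Twist.lTensor_map_injective`), and `M' ⊗ X ⟶ N' ⊗ X` is a monomorphism.

It remains to move `t` to the twisted side. Applying `act^*` to the morphisms `Z ⟶ X` and then using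
`act^* X ≅ p₁^* X = B ⊗ X` turns `t` into a morphism `T Z ⟶ M' ⊗ X` (`twistEval`). This is natural
in `M`, so it vanishes when `φ` kills `t`. Restriction to the unit section gives back the evaluation
of `t`, preceded by the counit `T Z ⟶ Z` (`twistEval_fromTwist`). The counit is an epimorphism, so
`t` evaluates to zero. Because `act^*` is only applied to morphisms `Z ⟶ X`, its exactness plays no
role. -/

namespace CatOverStack

/-! ### Reduction from arbitrary to finite coproducts in an AB5 category. -/

section FinitelyManyComponents

variable {C : Type u} [Category.{v} C] [Abelian C]
  [HasFilteredColimitsOfSize.{w, w} C] [AB5OfSize.{w, w} C]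

open CoproductsFromFiniteFiltered in
attribute [local instance] IsFiltered.isConnected in
/-- In an AB5 category, whether the kernel of a morphism out of a coproduct is killed by another
morphism can be tested on finite families of components. -/
theorem comp_sigmaDesc_eq_zero {I : Type w} {X W V : C} (f : I → (X ⟶ W)) (k : I → (X ⟶ V))
    (h : ∀ (Z : C) {σ : Type w} [Fintype σ] (i : σ → I) (z : σ → (Z ⟶ X)),
      ∑ s, z s ≫ f (i s) = 0 → ∑ s, z s ≫ k (i s) = 0)
    {Z : C} (x : Z ⟶ ∐ fun _ : I => X) (hx : x ≫ Sigma.desc f = 0) :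
    x ≫ Sigma.desc k = 0 := by
  -- The inclusion of the kernel is the universal choice of `x`.
  suffices H : kernel.ι (Sigma.desc f) ≫ Sigma.desc k = 0 by
    rw [← kernel.lift_ι (Sigma.desc f) x hx, Category.assoc, H, comp_zero]
  -- This is where AB5 enters: the coproduct is the filtered colimit of its finite subcoproducts, so
  -- a morphism out of the kernel vanishes as soon as it does on the pullback to each of them. On
  -- such a pullback only the components indexed by `F` occur.
  refine (isColimitFiniteSubproductsCocone (fun (_ : I) => X)).pullback_zero_ext (fun F => ?_)
  classical
  let P : C := pullback ((finiteSubcoproductsCocone fun _ : I => X).ι.app F)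
    (kernel.ι (Sigma.desc f))
  let q : P ⟶ ∐ fun x : F => X := pullback.fst ((finiteSubcoproductsCocone fun _ : I => X).ι.app F)
    (kernel.ι (Sigma.desc f))
  let ι : (∐ fun x : F => X) ⟶ ∐ fun _ : I => X :=
    Sigma.desc fun x : F => Sigma.ι (fun _ : I => X) x.1.as
  have hq : pullback.snd ((finiteSubcoproductsCocone fun _ : I => X).ι.app F)
    (kernel.ι (Sigma.desc f)) ≫ kernel.ι (Sigma.desc f) = q ≫ ι := pullback.condition.symm
  have hι : ι = ∑ x : F, Sigma.π (fun _ : F => X) x ≫ Sigma.ι (fun _ : I => X) x.1.as :=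
    finiteSubcoproductsCocone_ι_app_eq_sum (fun _ : I => X) F
  have e : ∀ {Y : C} (g : I → (X ⟶ Y)), q ≫ ι ≫ Sigma.desc g =
      ∑ x : F, (q ≫ Sigma.π (fun _ : F => X) x) ≫ g x.1.as := by
    intro Y g
    rw [hι, Preadditive.sum_comp, Preadditive.comp_sum]
    simp
  refine (Category.assoc _ _ _).symm.trans ((congrArg (· ≫ Sigma.desc k) hq).trans ?_)
  refine (Category.assoc _ _ _).trans ((e k).trans ?_)
  apply h P (fun x : F => x.1.as) (fun x => q ≫ Sigma.π (fun _ : F => X) x)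
  refine (e f).symm.trans ((Category.assoc _ _ _).symm.trans ?_)
  refine (congrArg (· ≫ Sigma.desc f) hq.symm).trans ?_
  refine (Category.assoc _ _ _).trans ?_
  rw [kernel.condition, comp_zero]

end FinitelyManyComponents

/-! ### Elements and relations of `M ⊗ X`. -/

namespace TensorFunctor

variable {C : Type u} [Category.{v} C] [Preadditive C] [HasCoproducts.{w} C] [HasCokernels C]
  {A : Type w} [CommRing A] [Linear A C] (X : C) {M N : ModuleCat.{w} A}

/-- The morphism `m ⊗ - : X ⟶ M ⊗[A] X`. -/
noncomputable def mk (m : M) : X ⟶ (tensorFunctor A X).obj M := tensorMk (linearActed A X) m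

theorem mk_add (m n : M) : mk X (m + n) = mk X m + mk X n := tensorMk_add _ m n

theorem mk_zero : mk X (0 : M) = 0 := tensorMk_zero _

theorem mk_smul (a : A) (m : M) : mk X (a • m) = a • mk X m := by
  refine (tensorMk_smul _ a m).trans ?_
  exact (Linear.smul_comp _ _ _ a (𝟙 X) (mk X m)).trans (by rw [Category.id_comp])

theorem mk_map (φ : M ⟶ N) (m : M) : mk X m ≫ (tensorFunctor A X).map φ = mk X (φ.hom m) :=
  tensorMk_functor_map X φ m

variable {X} in
theorem hom_ext {Z : C} {f g : (tensorFunctor A X).obj M ⟶ Z}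
    (h : ∀ m, mk X m ≫ f = mk X m ≫ g) : f = g :=
  tensor_hom_ext (linearActed A X) h

/-- The linear map `m ↦ m ⊗ -`. -/
noncomputable def mkₗ (M : ModuleCat.{w} A) : M →ₗ[A] (X ⟶ (tensorFunctor A X).obj M) where
  toFun := mk X
  map_add' := mk_add X
  map_smul' := mk_smul X

variable {X} in
/-- The morphism out of `M ⊗[A] X` given by a linear map `M → Hom(X, Z)`. -/
noncomputable def desc {Z : C} (φ : M →ₗ[A] (X ⟶ Z)) : (tensorFunctor A X).obj M ⟶ Z :=
  tensorDesc (linearActed A X) φ.toAddMonoidHom (fun r m => by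
    refine (φ.map_smul r m).trans ?_
    exact (by rw [Category.id_comp] : r • φ m = r • (𝟙 X ≫ φ m)).trans
      (Linear.smul_comp _ _ _ r (𝟙 X) (φ m)).symm)

variable {X} in
theorem mk_desc {Z : C} (φ : M →ₗ[A] (X ⟶ Z)) (m : M) : mk X m ≫ desc φ = φ m :=
  tensorMk_desc (linearActed A X) _ _ m

theorem epi_sigmaDesc_mk (M : ModuleCat.{w} A) : Epi (Sigma.desc fun m : M => mk X m) where
  left_cancellation f g h := hom_ext fun m => by
    simpa using Sigma.ι (fun _ : M => X) m ≫= h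

/-- The map of coproducts of copies of `X` attached to the relations of `M`. -/
noncomputable def rel (M : ModuleCat.{w} A) : (∐ fun _ : relations A M => X) ⟶ ∐ fun _ : M => X :=
  Sigma.desc fun r => r.1.sum fun m a => a • Sigma.ι (fun _ : M => X) m

omit [HasCokernels C] in
-- Lets the presentation be handled with the scalar multiplication of morphisms in place of the
-- tautological action on `X`.
theorem relationsMap_eq (M : ModuleCat.{w} A) : relationsMap M (linearActed A X) = rel X M := by
  refine Sigma.hom_ext _ _ fun r => ?_
  refine (Sigma.ι_desc _ _).trans (Eq.trans ?_ (Sigma.ι_desc (f := fun _ : relations A M => X)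
    (fun r => r.1.sum fun m a => a • Sigma.ι (fun _ : M => X) m) r).symm)
  refine Finset.sum_congr rfl fun m _ => ?_
  exact (Linear.smul_comp _ _ _ _ (𝟙 X) (Sigma.ι (fun _ : M => X) m)).trans
    (by rw [Category.id_comp])

theorem sigmaDesc_mk (M : ModuleCat.{w} A) : (Sigma.desc fun m : M => mk X m) =
    cokernel.π (relationsMap M (linearActed A X)) :=
  Sigma.hom_ext _ _ fun _ => Sigma.ι_desc _ _

theorem rel_sigmaDesc_mk (M : ModuleCat.{w} A) :
    rel X M ≫ (Sigma.desc fun m : M => mk X m) = 0 :=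
  (congrArg₂ (· ≫ ·) (relationsMap_eq X M).symm (sigmaDesc_mk X M)).trans
    (cokernel.condition (relationsMap M (linearActed A X)))

end TensorFunctor

theorem TensorFunctor.exact_rel {C : Type u} [Category.{v} C] [Abelian C] [HasCoproducts.{w} C]
    {A : Type w} [CommRing A] [Linear A C] (X : C) (M : ModuleCat.{w} A) :
    (ShortComplex.mk _ _ (rel_sigmaDesc_mk X M)).Exact := by
  -- Both maps of the complex have to be replaced by equal ones at once; with variables in their
  -- place the equalities can be substituted.
  have H : ∀ {U V W : C} (f f' : U ⟶ V) (g g' : V ⟶ W) (w : f ≫ g = 0) (w' : f' ≫ g' = 0),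
      f' = f → g = g' → (ShortComplex.mk f' g' w').Exact → (ShortComplex.mk f g w).Exact := by
    rintro U V W f _ g _ w w' rfl rfl h
    exact h
  exact H _ _ _ _ _ _ (relationsMap_eq X M) (sigmaDesc_mk X M)
    (ShortComplex.exact_cokernel (relationsMap M (linearActed A X)))

/-! ### A criterion for `φ ⊗ X` to be a monomorphism. -/

section Eval

open TensorFunctor TensorProduct

variable {C : Type u} [Category.{v} C] [Preadditive C] [HasCoproducts.{w} C] [HasCokernels C]
  {A : Type w} [CommRing A] [Linear A C] (X : C) {M : ModuleCat.{w} A}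

/-- The evaluation `z ⊗ m ↦ z ≫ (m ⊗ -)`. -/
noncomputable def tensorEval (Z : C) (M : ModuleCat.{w} A) :
    (Z ⟶ X) ⊗[A] M →ₗ[A] (Z ⟶ (tensorFunctor A X).obj M) :=
  TensorProduct.lift ((Linear.comp Z X ((tensorFunctor A X).obj M)).compl₂ (mkₗ X M))

theorem tensorEval_tmul {Z : C} (z : Z ⟶ X) (m : M) :
    tensorEval X Z M (z ⊗ₜ[A] m) = z ≫ mk X m := rfl

end Eval

section MonoCriterion

open TensorFunctor TensorProduct

variable {C : Type u} [Category.{v} C] [Abelian C]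
  [HasFilteredColimitsOfSize.{w, w} C] [AB5OfSize.{w, w} C]
  {A : Type w} [CommRing A] [Linear A C] (X : C) {M N : ModuleCat.{w} A}

/-- The functor `- ⊗[A] X` maps `φ` to a monomorphism as soon as the elements of
`Hom(Z, X) ⊗[A] M` killed by `φ` evaluate to zero, for all `Z`. -/
theorem mono_tensorFunctor_map (φ : M ⟶ N)
    (h : ∀ (Z : C) (t : (Z ⟶ X) ⊗[A] M), φ.hom.lTensor (Z ⟶ X) t = 0 → tensorEval X Z M t = 0) :
    Mono ((tensorFunctor A X).map φ) := by
  classical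
  -- An element `y` of `X^(M)` dies in `N ⊗ X` when its image in `X^(N)` is, after a refinement, a
  -- combination of relations. Indexing by elements of `M` and relations of `N` together makes this
  -- the vanishing of a single morphism out of one coproduct. Relations are given the value `0` in
  -- `M`, so that they do not contribute to the evaluation.
  let θ : M ⊕ relations A N → (N →₀ A) :=
    Sum.elim (fun m => Finsupp.single (φ.hom m) 1) Subtype.val
  let μ : M ⊕ relations A N → M := Sum.elim id 0
  have hμ : ∀ i, φ.hom (μ i) = Finsupp.linearCombination A (id : N → N) (θ i) := by
    rintro (m | r)
    · simp [μ, θ]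
    · exact (map_zero φ.hom).trans r.2.symm
  let f : M ⊕ relations A N → (X ⟶ ∐ fun _ : N => X) := fun i =>
    (θ i).sum fun n a => a • Sigma.ι (fun _ : N => X) n
  have key : ∀ {Z : C} (x : Z ⟶ ∐ fun _ : M ⊕ relations A N => X), x ≫ Sigma.desc f = 0 →
      x ≫ Sigma.desc (fun i => mk X (μ i)) = 0 := by
    intro Z x
    refine comp_sigmaDesc_eq_zero f _ ?_ x
    intro Z σ _ i z hz
    -- The component at `n` of the relation `hz`, read off by projecting `X^(N)` to its `n`-th
    -- summand.
    have hz' : ∀ n, ∑ s, θ (i s) n • z s = 0 := by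
      intro n
      have := congrArg (· ≫ Sigma.desc fun n' => if n' = n then 𝟙 X else 0) hz
      simp only [Preadditive.sum_comp, Category.assoc, zero_comp] at this
      rw [← this]
      refine Finset.sum_congr rfl fun s _ => ?_
      simp only [f, Finsupp.sum, Preadditive.sum_comp, Linear.smul_comp, colimit.ι_desc,
        Cofan.mk_ι_app, smul_ite, smul_zero, Finset.sum_ite_eq', Finsupp.mem_support_iff, ne_eq,
        ite_not]
      split_ifs with h0
      · rw [h0, zero_smul, comp_zero]
      · rw [Linear.comp_smul, Category.comp_id]
    -- Writing each `φ (μ i)` as the combination `θ i` of elements of `N` and collecting the terms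
    -- at `n` leaves the coefficient from `hz'`, so `φ` kills this element.
    have ht := h Z (∑ s, z s ⊗ₜ[A] μ (i s)) (by
      rw [map_sum]
      simp only [LinearMap.lTensor_tmul, hμ]
      let S : Finset N := Finset.univ.biUnion fun s => (θ (i s)).support
      have e : ∀ s, Finsupp.linearCombination A (id : N → N) (θ (i s)) =
          ∑ n ∈ S, θ (i s) n • n := by
        intro s
        rw [Finsupp.linearCombination_apply]
        exact Finsupp.sum_of_support_subset _
          (Finset.subset_biUnion_of_mem (fun s => (θ (i s)).support) (Finset.mem_univ s)) _
          (fun n _ => zero_smul _ _)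
      simp only [e, TensorProduct.tmul_sum]
      rw [Finset.sum_comm]
      refine Finset.sum_eq_zero fun n _ => ?_
      simp only [← TensorProduct.smul_tmul]
      rw [← TensorProduct.sum_tmul, hz', TensorProduct.zero_tmul])
    rw [map_sum] at ht
    exact ht
  refine Preadditive.mono_of_cancel_zero _ fun {Z} g hg => ?_
  have := epi_sigmaDesc_mk X M
  obtain ⟨Z₁, p₁, _, y, hy⟩ :=
    surjective_up_to_refinements_of_epi (Sigma.desc fun m : M => mk X m) g
  let a : (∐ fun _ : M => X) ⟶ ∐ fun _ : N => X :=
    Sigma.desc fun m => Sigma.ι (fun _ : N => X) (φ.hom m)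
  have ha : a ≫ (Sigma.desc fun n : N => mk X n) =
      (Sigma.desc fun m : M => mk X m) ≫ (tensorFunctor A X).map φ := by
    apply Sigma.hom_ext
    intro m
    simp [a, mk_map]
  obtain ⟨Z₂, p₂, _, r, hr⟩ := (exact_rel X N).exact_up_to_refinements (y ≫ a) (by
    change (y ≫ a) ≫ (Sigma.desc fun n : N => mk X n) = 0
    rw [Category.assoc, ha, ← Category.assoc, ← hy, Category.assoc, hg, comp_zero])
  change p₂ ≫ y ≫ a = r ≫ rel X N at hr
  let inl : (∐ fun _ : M => X) ⟶ ∐ fun _ : M ⊕ relations A N => X :=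
    Sigma.desc fun m => Sigma.ι (fun _ : M ⊕ relations A N => X) (Sum.inl m)
  let inr : (∐ fun _ : relations A N => X) ⟶ ∐ fun _ : M ⊕ relations A N => X :=
    Sigma.desc fun m => Sigma.ι (fun _ : M ⊕ relations A N => X) (Sum.inr m)
  have h₁ : inl ≫ Sigma.desc f = a := Sigma.hom_ext _ _ fun m => by simp [inl, f, a, θ]
  have h₂ : inr ≫ Sigma.desc f = rel X N := Sigma.hom_ext _ _ fun m => by simp [inr, f, rel, θ]
  have h₃ : inl ≫ Sigma.desc (fun i => mk X (μ i)) = Sigma.desc fun m : M => mk X m :=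
    Sigma.hom_ext _ _ fun m => by simp [inl, μ]
  have h₄ : inr ≫ Sigma.desc (fun i => mk X (μ i)) = 0 :=
    Sigma.hom_ext _ _ fun m => by simp [inr, μ, mk_zero]
  -- The lift of `g` to `X^(M)` minus the relations that kill its image: this dies in `X^(N)`, while
  -- its evaluation in `M ⊗ X` is `g` itself, up to refinement.
  have := key (p₂ ≫ y ≫ inl - r ≫ inr) (by
    simp only [Preadditive.sub_comp, Category.assoc, h₁, h₂, hr, sub_self])
  simp only [Preadditive.sub_comp, Category.assoc, h₃, h₄, comp_zero, sub_zero] at this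
  rw [← cancel_epi p₁, ← cancel_epi p₂, comp_zero, comp_zero, hy, this]

/-- A universally injective map of modules stays injective after tensoring with an object. -/
theorem mono_tensorFunctor_map_of_lTensor_injective (φ : M ⟶ N)
    (h : ∀ Z : C, Function.Injective (φ.hom.lTensor (Z ⟶ X))) :
    Mono ((tensorFunctor A X).map φ) :=
  mono_tensorFunctor_map X φ fun Z t ht => by
    rw [h Z (ht.trans (map_zero _).symm), map_zero]

end MonoCriterion

/-! ### Right exactness of `- ⊗ X`. -/

section RightExact

open TensorFunctor

variable {C : Type u} [Category.{v} C] [Abelian C] [HasCoproducts.{w} C]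
  {A : Type w} [CommRing A] [Linear A C] (X : C)

theorem epi_tensorFunctor_map {M N : ModuleCat.{w} A} (φ : M ⟶ N)
    (hφ : Function.Surjective φ.hom) : Epi ((tensorFunctor A X).map φ) where
  left_cancellation f g h := hom_ext fun n => by
    obtain ⟨m, rfl⟩ := hφ n
    rw [← mk_map, Category.assoc, Category.assoc, h]

/-- A morphism `M ⊗ X ⟶ Z` is a linear map `M → Hom(X, Z)`, so the cokernel property of `S.X₂ →
S.X₃` is inherited by the tensor products. -/
theorem exact_map_tensorFunctor {S : ShortComplex (ModuleCat.{w} A)} (hS : S.ShortExact) :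
    (S.map (tensorFunctor A X)).Exact := by
  have hg : Function.Surjective S.g.hom := (ModuleCat.epi_iff_surjective _).1 hS.epi_g
  have : Epi (S.map (tensorFunctor A X)).g := epi_tensorFunctor_map X S.g hg
  have hfg := (ShortComplex.ShortExact.moduleCat_exact_iff_function_exact S).1 hS.exact
  apply ShortComplex.exact_of_g_is_cokernel
  refine CokernelCofork.IsColimit.ofπ' _ _ fun {Z} (k : (tensorFunctor A X).obj S.X₂ ⟶ Z) hk => ?_
  replace hk : (tensorFunctor A X).map S.f ≫ k = 0 := hk
  let ψ : S.X₂ →ₗ[A] (X ⟶ Z) := (Linear.rightComp A X k).comp (mkₗ X S.X₂)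
  have hψ : S.g.hom.ker ≤ ψ.ker := by
    intro m hm
    obtain ⟨m', rfl⟩ := (hfg m).1 hm
    have e : mk X m' ≫ (tensorFunctor A X).map S.f ≫ k = 0 := by
      rw [hk, comp_zero]
    rw [← Category.assoc, mk_map] at e
    exact e
  let ψ' : S.X₃ →ₗ[A] (X ⟶ Z) :=
    (S.g.hom.ker.liftQ ψ hψ).comp (S.g.hom.quotKerEquivOfSurjective hg).symm.toLinearMap
  refine ⟨desc ψ', hom_ext fun m => ?_⟩
  have e : ψ' (S.g.hom m) = ψ m := by
    have : (S.g.hom.quotKerEquivOfSurjective hg).symm (S.g.hom m) = Submodule.Quotient.mk m := by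
      rw [LinearEquiv.symm_apply_eq]; rfl
    simp only [ψ', LinearMap.comp_apply, LinearEquiv.coe_coe, this]
    exact Submodule.liftQ_apply _ _ _
  change mk X m ≫ (tensorFunctor A X).map S.g ≫ desc ψ' = _
  rw [← Category.assoc, mk_map, mk_desc, e]
  rfl

/-- The functor `- ⊗[A] X` is exact if it preserves monomorphisms. -/
theorem isFlat_of_mono (h : ∀ {M N : ModuleCat.{w} A} (φ : M ⟶ N), Function.Injective φ.hom →
    Mono ((tensorFunctor A X).map φ)) : IsFlat A X := fun S hS =>
  { exact := exact_map_tensorFunctor X hS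
    mono_f := h S.f ((ModuleCat.mono_iff_injective _).1 hS.mono_f)
    epi_g := epi_tensorFunctor_map X S.g ((ModuleCat.epi_iff_surjective _).1 hS.epi_g) }

end RightExact

end CatOverStack

namespace CatOverStack

/-! ### Flatness of `B ⊗ H` over the second factor. The rings `A₁` and `A₂` are kept apart because
`B` carries two structures over the same ring in the application. -/

section Flatness

open TensorProduct

variable {A₁ A₂ E B H : Type*} [CommRing A₁] [CommRing A₂] [CommRing E] [CommRing B]
  [Algebra A₁ E] [Algebra A₂ E] [Algebra E B] [AddCommGroup H] [Module A₁ H]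

omit [Algebra A₁ E] [AddCommGroup H] [Module A₁ H] in
/-- A flat `E`-module tensored with an `E`-module that is flat over `A₂` is flat over `A₂`. -/
theorem flat_tensor_of_flat [Algebra A₂ B] [IsScalarTower A₂ E B] (Z : Type*) [AddCommGroup Z]
    [Module E Z] [Module A₂ Z] [IsScalarTower A₂ E Z] [Module.Flat E B] [Module.Flat A₂ Z] :
    Module.Flat A₂ (B ⊗[E] Z) := by
  rw [Module.Flat.iff_lTensor_preserves_injective_linearMap]
  intro P P' _ _ _ _ φ hφ
  -- By associativity the functor `(B ⊗ Z) ⊗ -` is `Z ⊗ -` over `A₂` followed by `B ⊗ -` over `E`,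
  -- and both preserve injectivity.
  let e := AlgebraTensorModule.assoc A₂ E E B Z P
  let e' := AlgebraTensorModule.assoc A₂ E E B Z P'
  have key : ∀ t, e' (φ.lTensor (B ⊗[E] Z) t) =
      (AlgebraTensorModule.lTensor E Z φ).lTensor B (e t) := by
    intro t
    induction t using TensorProduct.induction_on with
    | zero => simp only [map_zero]
    | add x y hx hy => simp only [map_add, hx, hy]
    | tmul x p =>
      induction x using TensorProduct.induction_on with
      | zero => simp only [TensorProduct.zero_tmul, map_zero]
      | add x y hx hy => simp only [TensorProduct.add_tmul, map_add, hx, hy]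
      | tmul b z => rfl
  have h₁ : Function.Injective (AlgebraTensorModule.lTensor E Z φ) :=
    Module.Flat.lTensor_preserves_injective_linearMap (M := Z) φ hφ
  have h₂ := Module.Flat.lTensor_preserves_injective_linearMap (M := B) _ h₁
  intro x y hxy
  apply e.injective
  apply h₂
  rw [← key, ← key, hxy]

/-- Factors the extension of scalars from `A₁` to `B` through `E`, as `B ⊗[E] (E ⊗[A₁] H)`. -/
theorem flat_baseChange_of_flat [Algebra A₁ B] [Algebra A₂ B] [IsScalarTower A₁ E B]
    [IsScalarTower A₂ E B] [Module.Flat E B] [Module.Flat A₂ (E ⊗[A₁] H)] :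
    Module.Flat A₂ (B ⊗[A₁] H) := by
  have := flat_tensor_of_flat (A₂ := A₂) (E := E) (B := B) (E ⊗[A₁] H)
  exact Module.Flat.of_linearEquiv
    ((AlgebraTensorModule.cancelBaseChange A₁ E B B H).restrictScalars A₂).symm

attribute [local instance] Algebra.TensorProduct.rightAlgebra in
omit [CommRing E] [CommRing B] [Algebra A₁ E] [Algebra A₂ E] [Algebra E B] in
variable (A₁ A₂ H) in
/-- Over a field, `(A₁ ⊗ A₂) ⊗[A₁] H = A₂ ⊗ H` is flat over `A₂`. -/
theorem flat_tensorProduct_tensor (k : Type*) [Field k] [Algebra k A₁] [Algebra k A₂] :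
    Module.Flat A₂ ((A₁ ⊗[k] A₂) ⊗[A₁] H) := by
  let := Module.compHom H (algebraMap k A₁)
  have : IsScalarTower k A₁ H := ⟨fun a b x => by
    rw [Algebra.smul_def, mul_smul]; rfl⟩
  -- The standard isomorphisms composed here do not see the action of `A₂`, so the composite is
  -- taken additively and its `A₂`-linearity is checked on pure tensors. The target is a base change
  -- from a field, hence flat.
  let e : (A₁ ⊗[k] A₂) ⊗[A₁] H ≃+ A₂ ⊗[k] H :=
    (TensorProduct.comm A₁ (A₁ ⊗[k] A₂) H).toAddEquiv.trans
      ((AlgebraTensorModule.cancelBaseChange k A₁ A₁ H A₂).toAddEquiv.trans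
        (TensorProduct.comm k H A₂).toAddEquiv)
  have he : ∀ a b h, e ((a ⊗ₜ b) ⊗ₜ h) = b ⊗ₜ (a • h) := fun _ _ _ => rfl
  refine Module.Flat.of_linearEquiv
    ({ e with map_smul' := ?_ } : (A₁ ⊗[k] A₂) ⊗[A₁] H ≃ₗ[A₂] A₂ ⊗[k] H)
  intro c x
  change e (c • x) = c • e x
  induction x using TensorProduct.induction_on with
  | zero => simp only [smul_zero, map_zero]
  | add x y hx hy => simp only [smul_add, map_add, hx, hy]
  | tmul x h =>
    induction x using TensorProduct.induction_on with
    | zero => simp only [TensorProduct.zero_tmul, smul_zero, map_zero]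
    | add x y hx hy => simp only [TensorProduct.add_tmul, smul_add, map_add, hx, hy]
    | tmul a b =>
      have : c • ((a ⊗ₜ[k] b) ⊗ₜ[A₁] h) = (a ⊗ₜ[k] (c * b)) ⊗ₜ[A₁] h := by
        rw [TensorProduct.smul_tmul', Algebra.smul_def]
        congr 1
        change (1 ⊗ₜ[k] c) * (a ⊗ₜ[k] b) = _
        rw [Algebra.TensorProduct.tmul_mul_tmul, one_mul]
      rw [this, he, he]
      rfl

variable {M N : Type v} [AddCommGroup M] [Module A₂ M] [AddCommGroup N] [Module A₂ N]

omit [CommRing E] [Algebra A₁ E] [Algebra A₂ E] [Algebra E B] in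
/-- If `B ⊗[A₁] H` is flat over `A₂`, then `H ⊗[A₁] (B ⊗[A₂] -)` preserves injectivity. -/
theorem lTensor_lTensor_injective [Algebra A₁ B] [Algebra A₂ B] [Module.Flat A₂ (B ⊗[A₁] H)]
    (φ : M →ₗ[A₂] N) (hφ : Function.Injective φ) :
    Function.Injective (((AlgebraTensorModule.lTensor B B φ).restrictScalars A₁).lTensor H) := by
  -- Both sides are `(B ⊗[A₁] H) ⊗[B] (B ⊗[A₂] P)`; naturality in `P` reduces the claim to the
  -- flatness of `B ⊗[A₁] H` over `A₂`.
  let e : ∀ (P : Type v) [AddCommGroup P] [Module A₂ P],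
      H ⊗[A₁] (B ⊗[A₂] P) ≃+ (B ⊗[A₁] H) ⊗[A₂] P := fun P _ _ =>
    (TensorProduct.comm A₁ H (B ⊗[A₂] P)).toAddEquiv.trans
      ((AlgebraTensorModule.cancelBaseChange A₁ B B (B ⊗[A₂] P) H).symm.toAddEquiv.trans
        ((TensorProduct.comm B (B ⊗[A₂] P) (B ⊗[A₁] H)).toAddEquiv.trans
          (AlgebraTensorModule.cancelBaseChange A₂ B B (B ⊗[A₁] H) P).toAddEquiv))
  have he : ∀ (P : Type v) [AddCommGroup P] [Module A₂ P] (h : H) (b : B) (p : P),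
      e P (h ⊗ₜ (b ⊗ₜ p)) = (b ⊗ₜ h) ⊗ₜ p := fun P _ _ h b p => by
    change (b • ((1 : B) ⊗ₜ[A₁] h)) ⊗ₜ[A₂] p = _
    rw [TensorProduct.smul_tmul', smul_eq_mul, mul_one]
  have key : ∀ t, e N (((AlgebraTensorModule.lTensor B B φ).restrictScalars A₁).lTensor H t) =
      φ.lTensor (B ⊗[A₁] H) (e M t) := by
    intro t
    induction t using TensorProduct.induction_on with
    | zero => simp only [map_zero]
    | add x y hx hy => simp only [map_add, hx, hy]
    | tmul h x =>
      induction x using TensorProduct.induction_on with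
      | zero => simp only [TensorProduct.tmul_zero, map_zero]
      | add x y hx hy => simp only [TensorProduct.tmul_add, map_add, hx, hy]
      | tmul b m =>
        rw [he, LinearMap.lTensor_tmul, LinearMap.lTensor_tmul, ← he]
        rfl
  have := Module.Flat.lTensor_preserves_injective_linearMap (M := B ⊗[A₁] H) φ hφ
  intro x y hxy
  apply (e M).injective
  apply this
  rw [← key, ← key, hxy]

end Flatness

/-! ### The twist of a module by the groupoid. -/

section Twist

open TensorProduct

variable {A₁ A₂ B : Type*} [CommRing A₁] [CommRing A₂] [CommRing B]

/-- For homomorphisms `f : A₁ → B` and `g : A₂ → B`, the module `B ⊗[A₂] M` formed with respect to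
`g`, regarded as a module over `A₁` through `f`. -/
def Twist (_f : A₁ →+* B) (g : A₂ →+* B) (M : Type*) [AddCommGroup M] [Module A₂ M] : Type _ :=
  letI := g.toAlgebra
  B ⊗[A₂] M

namespace Twist

variable (f : A₁ →+* B) (g : A₂ →+* B) (M : Type v) [AddCommGroup M] [Module A₂ M]

noncomputable instance : AddCommGroup (Twist f g M) :=
  letI := g.toAlgebra
  (inferInstance : AddCommGroup (B ⊗[A₂] M))

noncomputable instance : Module A₁ (Twist f g M) :=
  letI := f.toAlgebra
  letI := g.toAlgebra
  (inferInstance : Module A₁ (B ⊗[A₂] M))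

variable {M}

/-- The linear map `b ↦ b ⊗ m`. -/
noncomputable def mk (m : M) :
    letI := f.toAlgebra
    B →ₗ[A₁] Twist f g M :=
  letI := f.toAlgebra
  letI := g.toAlgebra
  { toFun := fun b => b ⊗ₜ[A₂] m
    map_add' := fun b c => TensorProduct.add_tmul b c m
    map_smul' := fun _ _ => rfl }

theorem mk_add (m n : M) : mk f g (m + n) = mk f g m + mk f g n :=
  letI := f.toAlgebra
  LinearMap.ext fun b => by
    let := g.toAlgebra
    exact TensorProduct.tmul_add b m n

theorem mk_smul (a : A₂) (m : M) (b : B) : mk f g (a • m) b = mk f g m (g a * b) := by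
  let := g.toAlgebra
  exact (TensorProduct.smul_tmul a b m).symm

variable {f g} in
/-- The linear map `b ⊗ m ↦ u b • m` for a homomorphism `u : B → A₂` with `u ∘ g = id`. -/
noncomputable def descend [Module A₁ M] (u : B →+* A₂) (hf : ∀ a (m : M), u (f a) • m = a • m)
    (hg : ∀ a, u (g a) = a) : Twist f g M →ₗ[A₁] M :=
  letI := f.toAlgebra
  letI := g.toAlgebra
  letI φ : B ⊗[A₂] M →+ M := TensorProduct.liftAddHom
      { toFun := fun b => (DistribSMul.toAddMonoidHom M (u b) : M →+ M)
        map_zero' := by ext m; simp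
        map_add' := fun b c => by ext m; simp [add_smul] }
      (fun a b m => by
        change u (g a * b) • m = u b • a • m
        rw [map_mul, hg, mul_comm, mul_smul])
  { φ with
    map_smul' := fun a x => by
      change φ (a • x) = a • φ x
      induction x using TensorProduct.induction_on with
      | zero =>
        rw [map_zero, smul_zero]
        exact (congrArg φ (smul_zero a)).trans (map_zero φ)
      | add x y hx hy =>
        rw [map_add, smul_add, ← hx, ← hy]
        exact (congrArg φ (smul_add a x y)).trans (map_add φ _ _)
      | tmul b m =>
        change u (f a * b) • m = a • u b • m
        rw [map_mul, mul_smul, hf] }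

variable {N : Type v} [AddCommGroup N] [Module A₂ N]

/-- Functoriality of `B ⊗[A₂] M` in `M`. -/
noncomputable def map (φ : M →ₗ[A₂] N) : Twist f g M →ₗ[A₁] Twist f g N :=
  letI := f.toAlgebra
  letI := g.toAlgebra
  (AlgebraTensorModule.lTensor B B φ).restrictScalars A₁

/-- If `B` is flat over `A₁ ⊗ A₂` over a field, then `M ↦ B ⊗[A₂] M` transforms injective maps into
universally injective maps of `A₁`-modules. -/
theorem lTensor_map_injective {k : Type*} [Field k] [Algebra k A₁] [Algebra k A₂] [Algebra k B]
    (f : A₁ →ₐ[k] B) (g : A₂ →ₐ[k] B)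
    (h : (Algebra.TensorProduct.lift f g (fun _ _ => mul_comm _ _) :
      A₁ ⊗[k] A₂ →ₐ[k] B).toRingHom.Flat)
    (φ : M →ₗ[A₂] N) (hφ : Function.Injective φ) (H : Type*) [AddCommGroup H] [Module A₁ H] :
    Function.Injective ((map (f : A₁ →+* B) (g : A₂ →+* B) φ).lTensor H) := by
  let := (f : A₁ →+* B).toAlgebra
  let := (g : A₂ →+* B).toAlgebra
  let := Algebra.TensorProduct.rightAlgebra (R := k) (A := A₁) (B := A₂)
  let := (Algebra.TensorProduct.lift f g (fun _ _ => mul_comm _ _) :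
      A₁ ⊗[k] A₂ →ₐ[k] B).toRingHom.toAlgebra
  have : IsScalarTower A₁ (A₁ ⊗[k] A₂) B := IsScalarTower.of_algebraMap_eq fun a => by
    exact (by rw [map_one, mul_one] : f a = f a * g 1)
  have : IsScalarTower A₂ (A₁ ⊗[k] A₂) B := IsScalarTower.of_algebraMap_eq fun a => by
    exact (by rw [map_one, one_mul] : g a = f 1 * g a)
  have : Module.Flat (A₁ ⊗[k] A₂) B := h
  have := flat_tensorProduct_tensor A₁ A₂ H k
  have := flat_baseChange_of_flat (A₁ := A₁) (A₂ := A₂) (E := A₁ ⊗[k] A₂) (B := B) (H := H)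
  exact lTensor_lTensor_injective φ hφ

end Twist

end Twist

end CatOverStack

namespace CatOverStack

/-! ### Inverse images, and restriction along a section. -/

namespace BaseChange

variable {A R R' : Type w} [CommRing A] [CommRing R] [CommRing R'] {C : Type u} [Category.{v} C]
  [Preadditive C] [Linear A C] [HasCoproducts.{w} C] [HasCokernels C] {f : A →+* R}
  (ψ : R →+* R') (g : A →+* R') (h : ∀ a, ψ (f a) = g a)

/-- The morphism `r' ⊗ - : Y ⟶ R' ⊗[R] Y`. -/
noncomputable def pullbackMk (Y : BaseChange f C) (r : R') : Y.obj ⟶ ((pullback ψ g h).obj Y).obj :=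
  letI := ψ.toAlgebra
  tensorMk Y.toActedObj r

theorem pullback_hom_ext {Y : BaseChange f C} {Z : C}
    {k l : ((pullback ψ g h).obj Y).obj ⟶ Z}
    (e : ∀ r, pullbackMk ψ g h Y r ≫ k = pullbackMk ψ g h Y r ≫ l) : k = l :=
  letI := ψ.toAlgebra
  tensor_hom_ext Y.toActedObj e

theorem pullbackMk_eq (Y : BaseChange f C) (r : R') :
    pullbackMk ψ g h Y r = toPullback ψ g h Y ≫ ((pullback ψ g h).obj Y).act r := by
  let := ψ.toAlgebra
  refine Eq.trans ?_ (tensorMk_mul Y.toActedObj r (1 : R')).symm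
  rw [_root_.mul_one]
  rfl

theorem act_toPullback (Y : BaseChange f C) (r : R) :
    Y.act r ≫ toPullback ψ g h Y = toPullback ψ g h Y ≫ ((pullback ψ g h).obj Y).act (ψ r) := by
  let := ψ.toAlgebra
  rw [← pullbackMk_eq]
  refine (tensorMk_smul Y.toActedObj r (1 : R')).symm.trans ?_
  rw [Algebra.smul_def, _root_.mul_one]
  rfl

theorem toPullback_naturality {Y Z : BaseChange f C} (k : Y ⟶ Z) :
    toPullback ψ g h Y ≫ ((pullback ψ g h).map k).hom = k.hom ≫ toPullback ψ g h Z := by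
  let := ψ.toAlgebra
  exact tensorMk_map (LinearMap.id : R' →ₗ[R] R') k.hom k.comm (1 : R')

section Section

variable (ψ : R →+* A) (h : ∀ a, ψ (f a) = RingHom.id A a)

theorem act_toPullback_section (Y : BaseChange f C) (r : R) :
    Y.act r ≫ toPullback ψ (RingHom.id A) h Y = ψ r • toPullback ψ (RingHom.id A) h Y := by
  have e := ((pullback ψ (RingHom.id A) h).obj Y).compat (ψ r)
  rw [RingHom.id_apply] at e
  rw [act_toPullback, e, Linear.comp_smul, Category.comp_id]

/-- On `A ⊗[R] Y` the morphism `a ⊗ -` is `a` times `1 ⊗ -`, so `1 ⊗ -` alone determines every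
morphism out of it. -/
theorem epi_toPullback_section (Y : BaseChange f C) : Epi (toPullback ψ (RingHom.id A) h Y) where
  left_cancellation k l e := pullback_hom_ext _ _ _ fun a => by
    have e' := ((pullback ψ (RingHom.id A) h).obj Y).compat a
    rw [RingHom.id_apply] at e'
    rw [pullbackMk_eq, e', Linear.comp_smul, Category.comp_id, Linear.smul_comp, Linear.smul_comp,
      e]

end Section

end BaseChange

namespace AffineGroupoid

variable {A B : Type w} [CommRing A] [Algebra ℂ A] [CommRing B] [Algebra ℂ B]
  {G : AffineGroupoid A B}

theorem unit_comp_p₂ (G : AffineGroupoid A B) (a : A) : G.unit (G.p₂ a) = a :=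
  congrArg (fun s : A →+* A => s a) (G.tgt_one (RingHom.id A))

variable {C : Type u} [Category.{v} C]

/-! ### The counit `T X ⟶ X` of the action. -/

section Counit

variable [Preadditive C] [Linear A C] [HasCoproducts.{w} C] [HasCokernels C]

namespace ActionData

variable (F : G.ActionData C)

open BaseChange

/-- The action of `B` on the object underlying `act^* X`. -/
def actT (X : C) (b : B) : F.T.obj X ⟶ F.T.obj X := (F.act.obj X).act b

/-- The object underlying `1^* act^* X`. -/
noncomputable def unitPullback (X : C) : C :=
  ((pullback G.unit (RingHom.id A) G.unit_comp_p₁).obj (F.act.obj X)).obj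

/-- The adjunction morphism from `act^* X` to `1^* act^* X`. -/
noncomputable def toUnitPullback (X : C) : F.T.obj X ⟶ F.unitPullback X :=
  toPullback G.unit (RingHom.id A) G.unit_comp_p₁ (F.act.obj X)

/-- The unit constraint. -/
noncomputable def unitPullbackIso (X : C) : F.unitPullback X ≅ X := F.unitIso.app X

theorem counit_eq (X : C) : F.counit X = F.toUnitPullback X ≫ (F.unitPullbackIso X).hom := rfl

/-- The counit factors through the restriction to the unit section, where `B` acts through `G.unit`.
-/
theorem actT_counit (X : C) (b : B) : F.actT X b ≫ F.counit X = G.unit b • F.counit X := by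
  have e : F.actT X b ≫ F.toUnitPullback X = G.unit b • F.toUnitPullback X :=
    act_toPullback_section G.unit G.unit_comp_p₁ (F.act.obj X) b
  rw [counit_eq, ← Category.assoc, e, Linear.smul_comp]

theorem counit_naturality {X Y : C} (k : X ⟶ Y) :
    F.T.map k ≫ F.counit Y = F.counit X ≫ k := by
  let k' : F.unitPullback X ⟶ F.unitPullback Y :=
    ((pullback G.unit (RingHom.id A) G.unit_comp_p₁).map (F.act.map k)).hom
  have e : F.toUnitPullback X ≫ k' = F.T.map k ≫ F.toUnitPullback Y :=
    toPullback_naturality G.unit (RingHom.id A) G.unit_comp_p₁ (F.act.map k)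
  have e' : k' ≫ (F.unitPullbackIso Y).hom = (F.unitPullbackIso X).hom ≫ k :=
    F.unitIso.hom.naturality k
  rw [counit_eq, counit_eq, ← Category.assoc, ← e, Category.assoc, Category.assoc, e']

instance epi_counit (X : C) : Epi (F.counit X) := by
  have : Epi (F.toUnitPullback X) :=
    epi_toPullback_section G.unit G.unit_comp_p₁ (F.act.obj X)
  rw [counit_eq]
  infer_instance

theorem T_map_add {X Y : C} (k l : X ⟶ Y) : F.T.map (k + l) = F.T.map k + F.T.map l :=
  F.map_add k l

theorem T_map_smul {X Y : C} (a : A) (k : X ⟶ Y) :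
    F.T.map (a • k) = F.T.map k ≫ F.actT Y (G.p₂ a) :=
  F.map_smul a k

end ActionData

/-! ### The equivariant structure `B ⊗ X ≅ act^* X` and its restriction to the unit. -/

namespace EquivariantObj

open BaseChange TensorFunctor

variable {F : G.Action C} (X : EquivariantObj F)

variable (G) in
/-- The ring `B` as an `A`-module through `p₁`. -/
noncomputable def sourceModule : ModuleCat.{w} A :=
  letI := (G.p₁ : A →+* B).toAlgebra
  ModuleCat.of A B

/-- The inverse `act^* X ⟶ p₁^* X = B ⊗[A] X` of the equivariant structure. -/
noncomputable def invHom : F.T.obj X.obj ⟶ (tensorFunctor A X.obj).obj (sourceModule G) :=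
  X.iso.inv.hom

/-- The equivariant structure `B ⊗[A] X = p₁^* X ⟶ act^* X`. -/
noncomputable def homHom : (tensorFunctor A X.obj).obj (sourceModule G) ⟶ F.T.obj X.obj :=
  X.iso.hom.hom

theorem homHom_invHom : X.homHom ≫ X.invHom = 𝟙 _ := congrArg Hom.hom X.iso.hom_inv_id

theorem invHom_homHom : X.invHom ≫ X.homHom = 𝟙 _ := congrArg Hom.hom X.iso.inv_hom_id

instance : IsIso X.homHom := ⟨X.invHom, X.homHom_invHom, X.invHom_homHom⟩

/-- Multiplication by `b` on `B`, as an endomorphism of the `A`-module `B`. -/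
noncomputable def mulHom (b : B) : sourceModule G ⟶ sourceModule G :=
  letI := (G.p₁ : A →+* B).toAlgebra
  ModuleCat.ofHom (LinearMap.mulLeft A b)

/-- The morphism `b ⊗ - : X ⟶ B ⊗[A] X`. -/
noncomputable def mkB (b : B) : X.obj ⟶ (tensorFunctor A X.obj).obj (sourceModule G) :=
  TensorFunctor.mk X.obj (M := sourceModule G) b

theorem mkB_map_mulHom (b c : B) :
    X.mkB c ≫ (tensorFunctor A X.obj).map (mulHom b) = X.mkB (b * c) :=
  mk_map X.obj (mulHom b) c

theorem mulHom_homHom (b : B) : (tensorFunctor A X.obj).map (mulHom b) ≫ X.homHom =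
    X.homHom ≫ F.actT X.obj b :=
  X.iso.hom.comm b

theorem actT_invHom (b : B) : F.actT X.obj b ≫ X.invHom =
    X.invHom ≫ (tensorFunctor A X.obj).map (mulHom b) :=
  X.iso.inv.comm b

/-- For `b = 1` this is the unit compatibility; the general case follows because the equivariant
structure commutes with `B`, which acts through `G.unit` after the counit. -/
theorem mkB_homHom_counit (b : B) :
    X.mkB b ≫ X.homHom ≫ F.counit X.obj = G.unit b • 𝟙 X.obj := by
  have h : (X.mkB 1 ≫ X.homHom) ≫ F.counit X.obj = 𝟙 X.obj := X.unit_compat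
  rw [Category.assoc] at h
  rw [← _root_.mul_one b, ← mkB_map_mulHom, Category.assoc,
    ← Category.assoc ((tensorFunctor A X.obj).map (mulHom b)), mulHom_homHom, Category.assoc,
    F.actT_counit, Linear.comp_smul, Linear.comp_smul, h, _root_.mul_one]

/-- Through the equivariant structure, the restriction `b ⊗ x ↦ unit b • x` to the unit section
becomes the counit. -/
theorem invHom_map_eq_counit {M : ModuleCat.{w} A} (k : sourceModule G ⟶ M) (m : M)
    (hk : ∀ b : B, k.hom b = G.unit b • m) :
    X.invHom ≫ (tensorFunctor A X.obj).map k = F.counit X.obj ≫ TensorFunctor.mk X.obj m := by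
  rw [← cancel_epi X.homHom, ← Category.assoc, homHom_invHom, Category.id_comp]
  refine TensorFunctor.hom_ext fun (b : B) => ?_
  have e := congrArg (· ≫ TensorFunctor.mk X.obj m) (X.mkB_homHom_counit b)
  simp only [Category.assoc, Linear.smul_comp, Category.id_comp] at e
  refine (mk_map X.obj k b).trans (Eq.trans ?_ e.symm)
  rw [← mk_smul]
  exact congrArg _ (hk b)

end EquivariantObj

end Counit

/-! ### Evaluation in the twisted module. -/

section Flat

open TensorProduct TensorFunctor

variable [Preadditive C] [Linear A C] [HasCoproducts.{w} C] [HasCokernels C] {F : G.Action C}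
  (X : EquivariantObj F)

namespace EquivariantObj

variable (G) in
/-- The `A`-module `B ⊗[A] M`, formed through `p₂` and regarded as an `A`-module through `p₁`. -/
noncomputable def twist (M : ModuleCat.{w} A) : ModuleCat.{w} A :=
  ModuleCat.of A (Twist (G.p₁ : A →+* B) (G.p₂ : A →+* B) M)

/-- The linear map `b ↦ b ⊗ m`. -/
noncomputable def toTwist {M : ModuleCat.{w} A} (m : M) : sourceModule G ⟶ twist G M :=
  letI := (G.p₁ : A →+* B).toAlgebra
  ModuleCat.ofHom (Twist.mk (G.p₁ : A →+* B) (G.p₂ : A →+* B) m)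

variable (G) in
/-- The restriction `b ⊗ m ↦ unit b • m` to the unit section. -/
noncomputable def fromTwist (M : ModuleCat.{w} A) : twist G M ⟶ M :=
  ModuleCat.ofHom (Twist.descend (f := (G.p₁ : A →+* B)) (g := (G.p₂ : A →+* B)) G.unit
    (fun a m => congrArg (· • m) (G.unit_comp_p₁ a)) G.unit_comp_p₂)

variable (G) in
/-- Functoriality of the twist. -/
noncomputable def twistMap {M N : ModuleCat.{w} A} (φ : M ⟶ N) : twist G M ⟶ twist G N :=
  ModuleCat.ofHom (Twist.map (G.p₁ : A →+* B) (G.p₂ : A →+* B) φ.hom)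

theorem toTwist_twistMap {M N : ModuleCat.{w} A} (φ : M ⟶ N) (m : M) :
    toTwist (G := G) m ≫ twistMap G φ = toTwist (φ.hom m) := rfl

theorem toTwist_fromTwist {M : ModuleCat.{w} A} (m : M) (b : B) :
    (toTwist (G := G) m ≫ fromTwist G M).hom b = G.unit b • m := rfl

theorem toTwist_add {M : ModuleCat.{w} A} (m n : M) :
    toTwist (G := G) (m + n) = toTwist m + toTwist n :=
  ModuleCat.hom_ext (Twist.mk_add (G.p₁ : A →+* B) (G.p₂ : A →+* B) m n)

theorem toTwist_smul {M : ModuleCat.{w} A} (a : A) (m : M) :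
    toTwist (G := G) (a • m) = mulHom (G.p₂ a) ≫ toTwist m := by
  ext (b : B)
  exact Twist.mk_smul (G.p₁ : A →+* B) (G.p₂ : A →+* B) a m b

/-- The morphisms `act^* Z ⟶ (B ⊗[A] M) ⊗[A] X` attached to the elements of `Hom(Z, X) ⊗[A] M` by
the functoriality of `act^*` and the equivariant structure of `X`. -/
noncomputable def twistEval (Z : C) (M : ModuleCat.{w} A) :
    (Z ⟶ X.obj) ⊗[A] M →+ (F.T.obj Z ⟶ (tensorFunctor A X.obj).obj (twist G M)) :=
  TensorProduct.liftAddHom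
    (AddMonoidHom.mk' (fun z => AddMonoidHom.mk'
      (fun m => F.T.map z ≫ X.invHom ≫ (tensorFunctor A X.obj).map (toTwist m))
      (fun m n => by
        rw [toTwist_add, Functor.map_add, Preadditive.comp_add, Preadditive.comp_add]))
      (fun z z' => by
        ext m
        exact (congrArg (· ≫ X.invHom ≫ (tensorFunctor A X.obj).map (toTwist m))
          (F.T_map_add z z')).trans (Preadditive.add_comp ..)))
    -- Compatibility with `A` fixes the form of the twist: `act^*` turns the scalar `a` into the
    -- action of `p₂ a`, which commutes with the equivariant structure and is absorbed by `b ⊗ a m =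
    -- p₂(a) b ⊗ m`.
    (fun a z m => by
      change F.T.map (a • z) ≫ X.invHom ≫ (tensorFunctor A X.obj).map (toTwist m) =
        F.T.map z ≫ X.invHom ≫ (tensorFunctor A X.obj).map (toTwist (a • m))
      rw [F.T_map_smul, toTwist_smul, Functor.map_comp, Category.assoc,
        ← Category.assoc (F.actT _ _), actT_invHom, Category.assoc])

theorem twistEval_tmul {Z : C} {M : ModuleCat.{w} A} (z : Z ⟶ X.obj) (m : M) :
    X.twistEval Z M (z ⊗ₜ m) =
      F.T.map z ≫ X.invHom ≫ (tensorFunctor A X.obj).map (toTwist m) := rfl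

theorem twistEval_naturality {Z : C} {M N : ModuleCat.{w} A} (φ : M ⟶ N)
    (t : (Z ⟶ X.obj) ⊗[A] M) :
    X.twistEval Z M t ≫ (tensorFunctor A X.obj).map (twistMap G φ) =
      X.twistEval Z N (φ.hom.lTensor _ t) := by
  induction t using TensorProduct.induction_on with
  | zero => rw [map_zero, map_zero, map_zero, zero_comp]
  | add x y hx hy => rw [map_add, map_add, map_add, Preadditive.add_comp, hx, hy]
  | tmul z m =>
    rw [LinearMap.lTensor_tmul, twistEval_tmul, twistEval_tmul, Category.assoc, Category.assoc,
      ← Functor.map_comp, toTwist_twistMap]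

/-- Restricting to the unit section turns the equivariant structure into the counit of `X`, and
naturality of the counit moves it past `z`. This recovers `t` from its twisted evaluation. -/
theorem twistEval_fromTwist {Z : C} {M : ModuleCat.{w} A} (t : (Z ⟶ X.obj) ⊗[A] M) :
    X.twistEval Z M t ≫ (tensorFunctor A X.obj).map (fromTwist G M) =
      F.counit Z ≫ tensorEval X.obj Z M t := by
  induction t using TensorProduct.induction_on with
  | zero => rw [map_zero, map_zero, zero_comp, comp_zero]
  | add x y hx hy => rw [map_add, map_add, Preadditive.add_comp, Preadditive.comp_add, hx, hy]
  | tmul z m =>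
    have e := X.invHom_map_eq_counit (toTwist m ≫ fromTwist G M) m (toTwist_fromTwist m)
    rw [twistEval_tmul, tensorEval_tmul, Category.assoc, Category.assoc, ← Functor.map_comp, e,
      ← Category.assoc, F.counit_naturality, Category.assoc]

end EquivariantObj

end Flat

end AffineGroupoid

end CatOverStack

open CatOverStack CatOverStack.AffineGroupoid in
theorem lemma16 {A B : Type w} [CommRing A] [Algebra ℂ A] [CommRing B] [Algebra ℂ B]
    (G : CatOverStack.AffineGroupoid A B) (hG : G.FlatOverSquare)
    {C : Type u} [Category.{v} C] [Abelian C] [Linear A C]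
    [HasFilteredColimitsOfSize.{w, w} C] [AB5OfSize.{w, w} C]
    (F : G.Action C) (X : CatOverStack.AffineGroupoid.EquivariantObj F) :
    CatOverStack.IsFlat A X.obj := by
  refine isFlat_of_mono X.obj fun {M N} φ hφ => mono_tensorFunctor_map X.obj φ fun Z t ht => ?_
  -- The only use of flatness over `S × S`.
  have : Mono ((tensorFunctor A X.obj).map (EquivariantObj.twistMap G φ)) :=
    mono_tensorFunctor_map_of_lTensor_injective X.obj _ fun Z =>
      Twist.lTensor_map_injective G.p₁ G.p₂ hG φ.hom hφ (Z ⟶ X.obj)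
  have h : X.twistEval Z M t = 0 := by
    rw [← cancel_mono ((tensorFunctor A X.obj).map (EquivariantObj.twistMap G φ)), zero_comp,
      X.twistEval_naturality, ht, map_zero]
  -- The counit is an epimorphism, so the untwisted evaluation may be tested after it.
  rw [← cancel_epi (F.counit Z), comp_zero, ← X.twistEval_fromTwist, h, zero_comp]
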